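/- **Setting.** Let $n\ge 1$, let $A_n=\{v\in\mathbb Z^{n+1}:\sum_k v_k=0\}$, let $L\subseteq A_n$ be a subgroup of finite index, let $\delta>0$ be real, and let $\Bbbk$ be a field. For a lattice $\Lambda\subseteq\mathbb Z^{n+1}$ let $I_\Lambda\subseteq\Bbbk[x_0,\dots,x_n]$ be the ideal generated by all $\mathbf x^{a}-\mathbf x^{b}$ with $a,b\in\mathbb N^{n+1}$, $a-b\in\Lambda$; it is *generic* if it is generated by binomials $\mathbf x^{a}-\mathbf x^{b}$ such that $a-b$ has full support (no zero coordinate). For lattices $L_1,L_2\subseteq\mathbb R^{n+1}$ let $d(L_1,L_2)=\inf\|B_1-B_2\|_2$ over all bases $B_1$ of $L_1$ and $B_2$ of $L_2$, written as matrices whose rows are the basis vectors, where $\|\cdot\|_2$ is the matrix norm induced by the Euclidean norms. A digraph on $v_0,\dots,v_n$ with adjacency matrix $A$ has Laplacian $\mathrm{diag}(\text{out-degrees})-A$. Inequalities between vectors are coordinatewise, and $u^{\pm}$ are the positive and negative parts of $u$. **Algorithm.** *Preprocessing:* choose a strongly connected digraph (multiple edges allowed) on $v_0,\dots,v_n$ such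 that the rows of its Laplacian $Q_0$ generate $L$ and the left kernel of $Q_0$ is spanned by a positive integer vector $\Sigma$ with $\Sigma_0=1$. *Iteration $r=0,1,2,\dots$:* let $\lambda_r$ be the least positive rational such that $\lambda_rQ_r$ is integral. If $((\lambda_rQ_r)^T x)_k\ne0$ for all integer vectors $x$ with $0\le x\le\Sigma$, $x\neq 0,\Sigma$, and all $k$, stop and output $Q_{\rm gen}=Q_r$, $\lambda=\lambda_r$, the lattice $L_{\rm gen}\subseteq\mathbb R^{n+1}$ generated by the rows of $Q_{\rm gen}$, and the set $$\mathcal G=\{\mathbf x^{u^+}-\mathbf x^{u^-}: u=(\lambda Q_{\rm gen})^Tx,\ x\in\mathbb Z^{n+1},\ 0\le x\le\Sigma\}.$$ Otherwise choose such an $x$ and an index $i$ with $((\lambda_rQ_r)^T x)_i=0$, an index $j$ with $x_j/\Sigma_j\ne x_i/\Sigma_i$, and let $\hat Q_r$ be the Laplacian of the weighted digraph with exactly two edges, $v_i\to v_j$ of weight $1/\Sigma_i$ and $v_j\to v_i$ of weight $1/\Sigma_j$. Choose a rational $\varepsilon_r>0$ such that $$\varepsilon_r<-\frac{(Q_r^Ty)_k}{(\hat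 Q_r^Ty)_k}\quad\text{for all integer vectors } 0\le y\le\Sigma \text{ and } k\in\{i,j\} \text{ with } (\hat Q_r^Ty)_k(Q_r^Ty)_k<0,$$ $$\varepsilon_r<\frac{\delta}{|\hat Q_r|_1\,(n+1)\prod_s\Sigma_s},$$ where $|\cdot|_1$ is the largest absolute column sum, and put $Q_{r+1}=Q_r+\varepsilon_r\hat Q_r$. **Theorem.** The preprocessing is possible. For every result of the preprocessing and all choices made in the iterations, the algorithm never gets stuck (each $\lambda_r$ exists; for each choice of $x,i$ there is an admissible $j$, and for each admissible $j$ an admissible $\varepsilon_r$) and it terminates (there is no infinite run). At every iteration the left kernel of $Q_r$ is spanned by $\Sigma$ and $\lambda_rQ_r$ is the Laplacian of a strongly connected digraph. When the algorithm stops, 1. $\lambda\cdot L_{\rm gen}\subseteq\mathbb Z^{n+1}$ is the lattice generated by the rows of $\lambda Q_{\rm gen}$; 2. $\mathcal G$ is a Gröbner basis of $I_{\lambda\cdot L_{\rm gen}}$ for every graded reverse lexicographic order in which the variables are ordered by a linear extension of the tree order of a directed spanning tree $T$ (all edges directed towards the root $v_0$) of the digraph with Laplacian $\lambda Q_{\rm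 gen}$, where $u\le v$ in the tree order if $T$ has a directed path from $v$ to $u$; 3. the lattice ideal $I_{\lambda\cdot L_{\rm gen}}$ is generic; 4. $d(L_{\rm gen},L)\le\delta$; in fact there are bases $B_{\rm gen}$ of $L_{\rm gen}$ and $B$ of $L$ with $\|B_{\rm gen}-B\|_2\le\delta$. -/

import Mathlib

namespace LatticeDeform

open Matrix MvPolynomial

variable {n : ℕ}

/-! ### Lattices and lattice ideals -/

/-- The root lattice `A_n`: integer vectors of length `n + 1` with coordinate sum zero. -/
def rootLattice (n : ℕ) : AddSubgroup (Fin (n + 1) → ℤ) where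
  carrier := {v | ∑ k, v k = 0}
  zero_mem' := by simp
  add_mem' := by
    intro a b (ha : ∑ k, a k = 0) (hb : ∑ k, b k = 0)
    change ∑ k, (a k + b k) = 0
    rw [Finset.sum_add_distrib, ha, hb, add_zero]
  neg_mem' := by
    intro a (ha : ∑ k, a k = 0)
    change ∑ k, -a k = 0
    rw [Finset.sum_neg_distrib, ha, neg_zero]

/-- The lattice generated by the rows of a matrix. -/
def rowLattice {R : Type*} [Ring R] (M : Matrix (Fin (n + 1)) (Fin (n + 1)) R) :
    AddSubgroup (Fin (n + 1) → R) :=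
  AddSubgroup.closure (Set.range fun i => M i)

/-- An integer lattice, viewed inside `ℝ^{n+1}`. -/
def toRealLattice (L : AddSubgroup (Fin (n + 1) → ℤ)) : AddSubgroup (Fin (n + 1) → ℝ) :=
  L.map ((Int.castAddHom ℝ).compLeft (Fin (n + 1)))

/-- The dilation `l · L` of a lattice in `ℝ^{n+1}`. -/
def dilate (l : ℝ) (L : AddSubgroup (Fin (n + 1) → ℝ)) : AddSubgroup (Fin (n + 1) → ℝ) :=
  L.map (DistribSMul.toAddMonoidHom (Fin (n + 1) → ℝ) l)

/-- The rows of `B` are a basis of the lattice `L`: they are linearly independent over `ℝ` and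
their integer combinations are exactly the points of `L`. -/
def IsLatticeBasis {r : ℕ} (B : Matrix (Fin r) (Fin (n + 1)) ℝ)
    (L : AddSubgroup (Fin (n + 1) → ℝ)) : Prop :=
  LinearIndependent ℝ (fun i => B i) ∧ AddSubgroup.closure (Set.range fun i => B i) = L

open scoped Matrix.Norms.L2Operator in
/-- All values `‖B₁ - B₂‖₂`, for bases `B₁` of `L₁` and `B₂` of `L₂` written as matrices (rows are
basis vectors); the matrix norm is the one induced by the Euclidean norms. -/
def basisDistances (L₁ L₂ : AddSubgroup (Fin (n + 1) → ℝ)) : Set ℝ :=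
  {t | ∃ (r : ℕ) (B₁ B₂ : Matrix (Fin r) (Fin (n + 1)) ℝ),
    IsLatticeBasis B₁ L₁ ∧ IsLatticeBasis B₂ L₂ ∧ t = ‖B₁ - B₂‖}

/-- The basis distance `d(L₁, L₂)`: the infimum of `‖B₁ - B₂‖₂` over all bases (it is `⊤` if there
is no pair of bases of the same size). -/
noncomputable def latticeDist (L₁ L₂ : AddSubgroup (Fin (n + 1) → ℝ)) : ENNReal :=
  ⨅ t ∈ basisDistances L₁ L₂, ENNReal.ofReal t

/-- The lattice ideal `I_L`, generated by all `x^a - x^b` with `a - b ∈ L`. -/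
noncomputable def latticeIdeal (𝕜 : Type*) [Field 𝕜] (L : AddSubgroup (Fin (n + 1) → ℤ)) :
    Ideal (MvPolynomial (Fin (n + 1)) 𝕜) :=
  Ideal.span {f | ∃ a b : Fin (n + 1) →₀ ℕ, (fun k => (a k : ℤ) - (b k : ℤ)) ∈ L ∧
    f = monomial a 1 - monomial b 1}

/-- An ideal is generic if it is generated by binomials `x^a - x^b` for which `a - b` has full
support. -/
def IsGenericIdeal {𝕜 : Type*} [Field 𝕜] (I : Ideal (MvPolynomial (Fin (n + 1)) 𝕜)) : Prop :=
  ∃ G : Set (MvPolynomial (Fin (n + 1)) 𝕜),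
    (∀ f ∈ G, ∃ a b : Fin (n + 1) →₀ ℕ, (∀ k, a k ≠ b k) ∧ f = monomial a 1 - monomial b 1) ∧
    Ideal.span G = I

/-! ### The graded reverse lexicographic order -/

/-- Exponent vectors, to be ordered by the graded reverse lexicographic order in which the variable
`x_v` is smaller than `x_w` when `ρ v < ρ w`. -/
def Grevlex (_ρ : Equiv.Perm (Fin (n + 1))) : Type := Fin (n + 1) →₀ ℕ

noncomputable instance (ρ : Equiv.Perm (Fin (n + 1))) : AddCommMonoid (Grevlex ρ) :=
  inferInstanceAs (AddCommMonoid (Fin (n + 1) →₀ ℕ))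

/-- The comparison key: first the degree, then the exponents, starting from the smallest variable
and in reversed order. -/
def grevlexKey (ρ : Equiv.Perm (Fin (n + 1))) (a : Grevlex ρ) :
    ℕ ×ₗ Lex (Fin (n + 1) → ℕᵒᵈ) :=
  toLex (∑ v, (show Fin (n + 1) →₀ ℕ from a) v,
    toLex fun k => OrderDual.toDual ((show Fin (n + 1) →₀ ℕ from a) (ρ.symm k)))

theorem grevlexKey_injective (ρ : Equiv.Perm (Fin (n + 1))) :
    Function.Injective (grevlexKey ρ) := by
  intro a b h
  have h2 := congrArg (fun p => ofLex (ofLex p).2) h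
  refine Finsupp.ext fun v => ?_
  have := congrFun h2 (ρ v)
  simpa [grevlexKey] using this

theorem grevlexKey_add (ρ : Equiv.Perm (Fin (n + 1))) (a b : Grevlex ρ) :
    grevlexKey ρ (a + b) = grevlexKey ρ a + grevlexKey ρ b := by
  have h : ∀ v, (show Fin (n + 1) →₀ ℕ from a + b) v =
      (show Fin (n + 1) →₀ ℕ from a) v + (show Fin (n + 1) →₀ ℕ from b) v := fun _ => rfl
  simp only [grevlexKey, h, Finset.sum_add_distrib]
  rfl

noncomputable instance (ρ : Equiv.Perm (Fin (n + 1))) : LinearOrder (Grevlex ρ) :=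
  LinearOrder.lift' (grevlexKey ρ) (grevlexKey_injective ρ)

instance (ρ : Equiv.Perm (Fin (n + 1))) : IsOrderedCancelAddMonoid (Grevlex ρ) :=
  Function.Injective.isOrderedCancelAddMonoid (grevlexKey ρ) (grevlexKey_add ρ) Iff.rfl

/-- The defining comparison of the graded reverse lexicographic order. -/
theorem grevlex_lt_iff (ρ : Equiv.Perm (Fin (n + 1))) (a b : Fin (n + 1) →₀ ℕ) :
    (show Grevlex ρ from a) < (show Grevlex ρ from b) ↔
      ∑ v, a v < ∑ v, b v ∨
        (∑ v, a v = ∑ v, b v ∧ ∃ v, b v < a v ∧ ∀ w, ρ w < ρ v → a w = b w) := by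
  change toLex (∑ v, a v, toLex fun k => OrderDual.toDual (a (ρ.symm k))) <
    toLex (∑ v, b v, toLex fun k => OrderDual.toDual (b (ρ.symm k))) ↔ _
  rw [Prod.Lex.toLex_lt_toLex]
  refine or_congr Iff.rfl (and_congr Iff.rfl ?_)
  constructor
  · rintro ⟨k, h1, h2⟩
    refine ⟨ρ.symm k, h2, fun w hw => ?_⟩
    have := h1 (ρ w) (by simpa using hw)
    simpa using this
  · rintro ⟨v, h1, h2⟩
    refine ⟨ρ v, fun j hj => ?_, ?_⟩
    · have := h2 (ρ.symm j) (by simpa using hj)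
      simpa using this
    · change OrderDual.toDual (a (ρ.symm (ρ v))) < OrderDual.toDual (b (ρ.symm (ρ v)))
      simpa using h1

theorem grevlex_monotone (ρ : Equiv.Perm (Fin (n + 1))) :
    Monotone fun a : Fin (n + 1) →₀ ℕ => (show Grevlex ρ from a) := by
  intro a b hab
  rcases eq_or_ne a b with rfl | hne
  · exact le_rfl
  · refine le_of_lt ((grevlex_lt_iff ρ a b).2 (Or.inl ?_))
    obtain ⟨v, hv⟩ : ∃ v, a v ≠ b v := by
      by_contra! h
      exact hne (Finsupp.ext h)
    exact Finset.sum_lt_sum (fun w _ => hab w) ⟨v, Finset.mem_univ _, lt_of_le_of_ne (hab v) hv⟩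

/-- The graded reverse lexicographic order with `x_v` smaller than `x_w` when `ρ v < ρ w`. -/
noncomputable def grevlex (ρ : Equiv.Perm (Fin (n + 1))) : MonomialOrder (Fin (n + 1)) where
  syn := Grevlex ρ
  toSyn :=
    { toFun := fun a => a
      invFun := fun a => a
      left_inv := fun _ => rfl
      right_inv := fun _ => rfl
      map_add' := fun _ _ => rfl }
  toSyn_monotone := grevlex_monotone ρ
  wellFoundedLT_syn := by
    have h : WellQuasiOrderedLE (Grevlex ρ) :=
      Monotone.wellQuasiOrderedLE_of_wellQuasiOrderedLE_of_surjective
        (grevlex_monotone ρ) Function.surjective_id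
    infer_instance

/-- `G` is a Gröbner basis of `I`: a finite subset of `I` whose leading terms generate the ideal of
all leading terms of `I`. -/
def IsGroebnerBasis {𝕜 : Type*} [Field 𝕜] (m : MonomialOrder (Fin (n + 1)))
    (I : Ideal (MvPolynomial (Fin (n + 1)) 𝕜)) (G : Set (MvPolynomial (Fin (n + 1)) 𝕜)) : Prop :=
  G.Finite ∧ G ⊆ I ∧
    Ideal.span (m.leadingTerm '' G) =
      Ideal.span (m.leadingTerm '' (I : Set (MvPolynomial (Fin (n + 1)) 𝕜)))

/-! ### Directed graphs and chip-firing -/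

/-- The Laplacian `D - A` of the weighted digraph with adjacency matrix `A`, where `D` is the
diagonal matrix of out-degrees. -/
def laplacian {R : Type*} [Ring R] (A : Matrix (Fin (n + 1)) (Fin (n + 1)) R) :
    Matrix (Fin (n + 1)) (Fin (n + 1)) R :=
  Matrix.diagonal (fun i => ∑ j, A i j) - A

/-- The multidigraph with `A i j` edges from `v_i` to `v_j` is strongly connected. -/
def StronglyConnected (A : Matrix (Fin (n + 1)) (Fin (n + 1)) ℕ) : Prop :=
  ∀ u v, Relation.ReflTransGen (fun a b => 0 < A a b) u v

/-- The left kernel of `Q` is the line spanned by `S`. -/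
def SpansLeftKernel (Q : Matrix (Fin (n + 1)) (Fin (n + 1)) ℚ) (S : Fin (n + 1) → ℕ) : Prop :=
  ∀ v : Fin (n + 1) → ℚ, v ᵥ* Q = 0 ↔ ∃ c : ℚ, v = fun i => c * (S i : ℚ)

/-- `T` (where `T v w` means that the edge from `v` to `w` is used) is a directed spanning tree of
the digraph `A`, all of whose edges point towards the root `v_0`. -/
def IsSpanningTree (A : Matrix (Fin (n + 1)) (Fin (n + 1)) ℕ)
    (T : Fin (n + 1) → Fin (n + 1) → Prop) : Prop :=
  (∀ v w, T v w → 0 < A v w) ∧ (∀ w, ¬ T 0 w) ∧ (∀ v, v ≠ 0 → ∃! w, T v w) ∧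
    ∀ v, Relation.ReflTransGen T v 0

/-- The total order of the vertices by the values of `ρ` is a linear extension of the tree order of
`T`, in which `u ≤ v` if there is a directed path from `v` to `u` in `T`. -/
def IsLinearExtension (T : Fin (n + 1) → Fin (n + 1) → Prop)
    (ρ : Equiv.Perm (Fin (n + 1))) : Prop :=
  ∀ u v, Relation.ReflTransGen T v u → ρ u ≤ ρ v

/-- The exponent vector `Mᵀ x` of the firing `x`. -/
def firing (M : Matrix (Fin (n + 1)) (Fin (n + 1)) ℤ) (x : Fin (n + 1) → ℕ) :
    Fin (n + 1) → ℤ :=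
  Mᵀ *ᵥ fun i => (x i : ℤ)

/-- The positive part `u⁺` of an integer vector, as an exponent vector. -/
noncomputable def posExponent (u : Fin (n + 1) → ℤ) : Fin (n + 1) →₀ ℕ :=
  Finsupp.equivFunOnFinite.symm fun k => (u k).toNat

/-- The binomials `x^{u⁺} - x^{u⁻}` with `u = Mᵀ x` and `0 ≤ x ≤ S`. -/
def chipBinomials (𝕜 : Type*) [Field 𝕜] (M : Matrix (Fin (n + 1)) (Fin (n + 1)) ℤ)
    (S : Fin (n + 1) → ℕ) : Set (MvPolynomial (Fin (n + 1)) 𝕜) :=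
  {f | ∃ x : Fin (n + 1) → ℕ, x ≤ S ∧
    f = monomial (posExponent (firing M x)) 1 - monomial (posExponent (-firing M x)) 1}

/-- The chip-firing binomials of `M` all have full support; `x = 0` and `x = S`, which give the
zero binomial, are not considered. (On functions, `x < S` means `x ≤ S` and `x ≠ S`.) -/
def HasFullSupport (M : Matrix (Fin (n + 1)) (Fin (n + 1)) ℤ) (S : Fin (n + 1) → ℕ) : Prop :=
  ∀ x : Fin (n + 1) → ℕ, 0 < x → x < S → ∀ k, firing M x k ≠ 0

/-! ### The deformation algorithm -/

/-- Possible results of the preprocessing of `L`: a strongly connected digraph `A` such that the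
rows of its Laplacian generate `L`, and the positive integer vector `S` with `S 0 = 1` that spans
the left kernel of the Laplacian. -/
structure IsPreprocessed (L : AddSubgroup (Fin (n + 1) → ℤ))
    (A : Matrix (Fin (n + 1)) (Fin (n + 1)) ℕ) (S : Fin (n + 1) → ℕ) : Prop where
  stronglyConnected : StronglyConnected A
  rows : rowLattice (laplacian (A.map ((↑) : ℕ → ℤ))) = L
  pos : ∀ i, 0 < S i
  zero : S 0 = 1
  kernel : SpansLeftKernel (laplacian (A.map ((↑) : ℕ → ℚ))) S

/-- `l` is the least positive rational such that `l • Q` is integral, and `M = l • Q`. -/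
def IsScaling (Q : Matrix (Fin (n + 1)) (Fin (n + 1)) ℚ) (l : ℚ)
    (M : Matrix (Fin (n + 1)) (Fin (n + 1)) ℤ) : Prop :=
  IsLeast {t : ℚ | 0 < t ∧
    ∃ N : Matrix (Fin (n + 1)) (Fin (n + 1)) ℤ, t • Q = N.map ((↑) : ℤ → ℚ)} l ∧
  l • Q = M.map ((↑) : ℤ → ℚ)

/-- The firing `x` and the index `i` witness that the binomials of `M` do not have full support. -/
def IsDefect (M : Matrix (Fin (n + 1)) (Fin (n + 1)) ℤ) (S x : Fin (n + 1) → ℕ)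
    (i : Fin (n + 1)) : Prop :=
  0 < x ∧ x < S ∧ firing M x i = 0

/-- The Laplacian of the weighted 2-cycle with an edge from `v_i` to `v_j` of weight `1 / S i` and
an edge from `v_j` to `v_i` of weight `1 / S j`. -/
def twoCycle (S : Fin (n + 1) → ℕ) (i j : Fin (n + 1)) :
    Matrix (Fin (n + 1)) (Fin (n + 1)) ℚ :=
  laplacian (Matrix.single i j (1 / (S i : ℚ)) + Matrix.single j i (1 / (S j : ℚ)))

/-- The matrix norm `|M|₁`: the largest absolute column sum. -/
def oneNorm (M : Matrix (Fin (n + 1)) (Fin (n + 1)) ℚ) : ℚ :=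
  Finset.univ.sup' Finset.univ_nonempty fun c => ∑ r, |M r c|

/-- The conditions on the multiple `ε` of `twoCycle S i j` that is added to `Q`. -/
def IsAdmissible (S : Fin (n + 1) → ℕ) (δ : ℝ) (Q : Matrix (Fin (n + 1)) (Fin (n + 1)) ℚ)
    (i j : Fin (n + 1)) (ε : ℚ) : Prop :=
  0 < ε ∧
  (∀ y : Fin (n + 1) → ℕ, y ≤ S → ∀ k, (k = i ∨ k = j) →
    ((twoCycle S i j)ᵀ *ᵥ fun s => (y s : ℚ)) k * (Qᵀ *ᵥ fun s => (y s : ℚ)) k < 0 →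
    ε < -((Qᵀ *ᵥ fun s => (y s : ℚ)) k / ((twoCycle S i j)ᵀ *ᵥ fun s => (y s : ℚ)) k)) ∧
  (ε : ℝ) < δ / ((oneNorm (twoCycle S i j) : ℝ) * (n + 1) * ∏ s, (S s : ℝ))

/-- One iteration of the algorithm, with any of the permitted choices of `x`, `i`, `j`, `ε`. -/
def Step (S : Fin (n + 1) → ℕ) (δ : ℝ) (Q Q' : Matrix (Fin (n + 1)) (Fin (n + 1)) ℚ) : Prop :=
  ∃ (l : ℚ) (M : Matrix (Fin (n + 1)) (Fin (n + 1)) ℤ), IsScaling Q l M ∧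
    ∃ (x : Fin (n + 1) → ℕ) (i j : Fin (n + 1)) (ε : ℚ), IsDefect M S x i ∧
      (x j : ℚ) / S j ≠ (x i : ℚ) / S i ∧ IsAdmissible S δ Q i j ε ∧
      Q' = Q + ε • twoCycle S i j

end LatticeDeform

namespace LatticeDeform

open Matrix MvPolynomial

variable {n : ℕ}

/-! ### Laplacians -/

section Laplacian

variable {R : Type*} [Ring R]

/-! The algorithm watches the vectors `Qᵀ y` with `0 ≤ y ≤ S`, so only finitely many pairs (firing,
coordinate) matter. The Laplacian of a weighted two-cycle on `i`, `j` has rank one: adding `ε` times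
it changes only the coordinates `i` and `j` of `Qᵀ y`, by `±ε (y i / S i - y j / S j)`. The upper
bounds on `ε` keep every nonzero coordinate nonzero, while the chosen defect disappears, so the
number of vanishing pairs drops at each step and the algorithm terminates
(`card_zeroPairs_lt_of_step`).

The same argument shows that no pair `{i, j}` is used twice: after its first use, coordinate `i`
stays nonzero for every `y` that could lead to this pair again. Hence perturbations do not
accumulate, and `Q` is the original Laplacian plus the Laplacian of weights `e i j / S i`, with `e`
symmetric, nonnegative and each entry bounded by one admissible `ε` (`IsDeformation`). Symmetry
keeps `S` in the left kernel, nonnegativity keeps the graph strongly connected, and the size bound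
controls the distance to `L` through the Schur test. Since `S 0 = 1`, the rows other than row `0`
form bases of both lattices.

The algebra is chip-firing. If firing `σ` is legal from the exponent `a`, so is its top layer modulo
`S`, a vector between `0` and `S` (`exists_legal_layer`). Peeling off layers shows that the chip
binomials generate the lattice ideal, so full support makes it generic. If moreover `σ 0 = 0`, the
layer avoids the root and moves chips towards it, which lowers the monomial in the tree-compatible
reverse lexicographic order (`exists_first_neg`). So every monomial that is not minimal in its class
is divisible by the leading monomial of a chip binomial, which is the Gröbner property.

For the preprocessing, a root lattice vector is encoded by its tail sums. There the sign pattern of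
a Laplacian row becomes monotonicity, and a suitable triangular basis of `L`, completed by one
negative combination of its vectors, is a strongly connected Laplacian (`exists_isPreprocessed`). -/

theorem laplacian_apply (A : Matrix (Fin (n + 1)) (Fin (n + 1)) R) (i j : Fin (n + 1)) :
    laplacian A i j = (if i = j then ∑ k, A i k else 0) - A i j := by
  simp [laplacian, Matrix.diagonal_apply]

theorem laplacian_add (A B : Matrix (Fin (n + 1)) (Fin (n + 1)) R) :
    laplacian (A + B) = laplacian A + laplacian B := by
  ext i j
  by_cases h : i = j <;> simp [laplacian_apply, h, Finset.sum_add_distrib] <;> abel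

theorem laplacian_smul (c : R) (A : Matrix (Fin (n + 1)) (Fin (n + 1)) R) :
    laplacian (c • A) = c • laplacian A := by
  ext i j
  by_cases h : i = j <;> simp [laplacian_apply, h, Finset.mul_sum, mul_sub]

theorem laplacian_map {R' : Type*} [Ring R'] (f : R →+* R')
    (A : Matrix (Fin (n + 1)) (Fin (n + 1)) R) : laplacian (A.map f) = (laplacian A).map f := by
  ext i j
  by_cases h : i = j <;> simp [laplacian_apply, h]

theorem laplacian_row_sum (A : Matrix (Fin (n + 1)) (Fin (n + 1)) R) (i : Fin (n + 1)) :
    ∑ j, laplacian A i j = 0 := by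
  simp [laplacian_apply, Finset.sum_sub_distrib]

theorem transpose_laplacian_mulVec {K : Type*} [CommRing K]
    (A : Matrix (Fin (n + 1)) (Fin (n + 1)) K) (y : Fin (n + 1) → K) (k : Fin (n + 1)) :
    ((laplacian A)ᵀ *ᵥ y) k = y k * ∑ j, A k j - ∑ s, y s * A s k := by
  simp only [Matrix.mulVec, dotProduct, laplacian_apply, Matrix.transpose_apply, sub_mul,
    Finset.sum_sub_distrib, ite_mul, zero_mul, Finset.sum_ite_eq', Finset.mem_univ, if_true]
  simp only [mul_comm]

/-- A matrix with zero row sums is the Laplacian of its negated off-diagonal part. -/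
theorem eq_laplacian_of_row_sum {M A : Matrix (Fin (n + 1)) (Fin (n + 1)) R}
    (hsum : ∀ i, ∑ j, M i j = 0) (hoff : ∀ i j, i ≠ j → M i j = -A i j) : M = laplacian A := by
  ext i j
  by_cases h : i = j
  · subst h
    have h1 := hsum i
    rw [← Finset.add_sum_erase _ _ (Finset.mem_univ i)] at h1
    rw [laplacian_apply, if_pos rfl, ← Finset.add_sum_erase _ _ (Finset.mem_univ i),
      eq_neg_of_add_eq_zero_left h1, ← Finset.sum_neg_distrib, add_sub_cancel_left]
    refine Finset.sum_congr rfl fun k hk => ?_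
    rw [hoff i k (Finset.ne_of_mem_erase hk).symm, neg_neg]
  · simp [laplacian_apply, h, hoff i j h]

end Laplacian

/-- The left kernel of a matrix with nonpositive off-diagonal entries and strongly connected
support is spanned by any positive vector in it. -/
theorem vecMul_eq_zero_iff_of_stronglyConnected {K : Type*} [Field K] [LinearOrder K]
    [IsStrictOrderedRing K] {Q : Matrix (Fin (n + 1)) (Fin (n + 1)) K} {S : Fin (n + 1) → K}
    {r : Fin (n + 1) → Fin (n + 1) → Prop} (hS : ∀ i, 0 < S i) (hSQ : S ᵥ* Q = 0)
    (hoff : ∀ i j, i ≠ j → Q i j ≤ 0) (hr : ∀ i j, r i j → i ≠ j → Q i j < 0)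
    (hconn : ∀ i j, Relation.ReflTransGen r i j) (v : Fin (n + 1) → K) :
    v ᵥ* Q = 0 ↔ ∃ c : K, v = fun i => c * S i := by
  constructor
  · intro hv
    -- Minimum principle: subtracting the multiple of `S` given by the smallest ratio leaves a
    -- nonnegative kernel vector that vanishes at `m`. In the column equation at a zero coordinate
    -- all terms are nonpositive, so the zero spreads backwards along edges.
    obtain ⟨m, hm⟩ := Finite.exists_min fun i => v i / S i
    refine ⟨v m / S m, ?_⟩
    have hw0 : ∀ i, 0 ≤ v i - v m / S m * S i := fun i => by
      have := (le_div_iff₀ (hS i)).1 (hm i)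
      linarith
    have hwQ : ∀ j, ∑ i, (v i - v m / S m * S i) * Q i j = 0 := fun j => by
      have h1 := congrFun hv j
      have h2 := congrFun hSQ j
      simp only [Matrix.vecMul, dotProduct, Pi.zero_apply] at h1 h2
      simp only [sub_mul, Finset.sum_sub_distrib, mul_assoc, ← Finset.mul_sum, h1, h2]
      simp
    have hz : ∀ i, v i - v m / S m * S i = 0 := fun i => by
      refine Relation.ReflTransGen.head_induction_on
        (motive := fun a _ => v a - v m / S m * S a = 0) (hconn i m) ?_ ?_
      · rw [div_mul_cancel₀ _ (hS m).ne', sub_self]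
      · intro a b hab _ hb
        by_cases hne : a = b
        · rw [hne, hb]
        have hle : ∀ i ∈ Finset.univ, (v i - v m / S m * S i) * Q i b ≤ 0 := fun i _ => by
          by_cases hib : i = b
          · rw [hib, hb, zero_mul]
          · exact mul_nonpos_of_nonneg_of_nonpos (hw0 i) (hoff i b hib)
        have := (Finset.sum_eq_zero_iff_of_nonpos hle).1 (hwQ b) a (Finset.mem_univ a)
        exact (mul_eq_zero.1 this).resolve_right (hr a b hab hne).ne
    funext i
    exact sub_eq_zero.1 (hz i)
  · rintro ⟨c, rfl⟩
    funext j
    have h2 := congrFun hSQ j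
    simp only [Matrix.vecMul, dotProduct, Pi.zero_apply] at h2 ⊢
    simp only [mul_assoc, ← Finset.mul_sum, h2, mul_zero]

/-! ### Lattices spanned by rows -/

theorem mem_rowLattice_iff {R : Type*} [Ring R] (M : Matrix (Fin (n + 1)) (Fin (n + 1)) R)
    (v : Fin (n + 1) → R) : v ∈ rowLattice M ↔ ∃ s : Fin (n + 1) → ℤ, ∑ i, s i • M i = v := by
  rw [rowLattice, ← Submodule.span_int_eq_addSubgroupClosure, Submodule.mem_toAddSubgroup,
    Submodule.mem_span_range_iff_exists_fun]

theorem mem_rowLattice_int_iff (M : Matrix (Fin (n + 1)) (Fin (n + 1)) ℤ)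
    (v : Fin (n + 1) → ℤ) : v ∈ rowLattice M ↔ ∃ s : Fin (n + 1) → ℤ, Mᵀ *ᵥ s = v := by
  rw [mem_rowLattice_iff]
  refine exists_congr fun s => ?_
  rw [Matrix.mulVec_transpose, Matrix.vecMul_eq_sum]

theorem map_rowLattice {R R' : Type*} [Ring R] [Ring R'] (f : (Fin (n + 1) → R) →+ (Fin (n + 1) → R'))
    (M : Matrix (Fin (n + 1)) (Fin (n + 1)) R) (M' : Matrix (Fin (n + 1)) (Fin (n + 1)) R')
    (h : ∀ i, f (M i) = M' i) : (rowLattice M).map f = rowLattice M' := by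
  rw [rowLattice, AddMonoidHom.map_closure, ← Set.range_comp, rowLattice]
  congr 2
  funext i
  exact h i

theorem toRealLattice_rowLattice (M : Matrix (Fin (n + 1)) (Fin (n + 1)) ℤ) :
    toRealLattice (rowLattice M) = rowLattice (M.map ((↑) : ℤ → ℝ)) :=
  map_rowLattice _ _ _ fun _ => rfl

theorem dilate_rowLattice (l : ℝ) (M : Matrix (Fin (n + 1)) (Fin (n + 1)) ℝ) :
    dilate l (rowLattice M) = rowLattice (l • M) :=
  map_rowLattice _ _ _ fun _ => rfl

/-- If the row relation `S` has `S 0 = 1`, then the rows other than row `0` generate. -/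
theorem closure_succ_rows {M : Matrix (Fin (n + 1)) (Fin (n + 1)) ℝ} {S : Fin (n + 1) → ℕ}
    (h0 : S 0 = 1) (hS : (fun i => (S i : ℝ)) ᵥ* M = 0) :
    AddSubgroup.closure (Set.range fun i : Fin n => M i.succ) = rowLattice M := by
  apply le_antisymm
  · refine AddSubgroup.closure_mono ?_
    rintro _ ⟨i, rfl⟩
    exact ⟨i.succ, rfl⟩
  · rw [rowLattice, AddSubgroup.closure_le]
    rintro _ ⟨i, rfl⟩
    rcases Fin.eq_zero_or_eq_succ i with rfl | ⟨i, rfl⟩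
    swap
    · exact AddSubgroup.subset_closure (Set.mem_range_self i)
    rw [Matrix.vecMul_eq_sum, Fin.sum_univ_succ, h0, Nat.cast_one, one_smul] at hS
    change M 0 ∈ _
    rw [eq_neg_of_add_eq_zero_left hS]
    refine neg_mem (sum_mem fun i _ => ?_)
    rw [Nat.cast_smul_eq_nsmul]
    exact nsmul_mem (AddSubgroup.subset_closure (Set.mem_range_self i)) _

/-- If the left kernel is spanned by `S` with `S 0 ≠ 0`, then the rows other than row `0` are
linearly independent. -/
theorem linearIndependent_succ_rows {M : Matrix (Fin (n + 1)) (Fin (n + 1)) ℝ}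
    {S : Fin (n + 1) → ℝ} (h0 : S 0 ≠ 0)
    (hker : ∀ v : Fin (n + 1) → ℝ, v ᵥ* M = 0 → ∃ c : ℝ, v = fun i => c * S i) :
    LinearIndependent ℝ (fun i : Fin n => M i.succ) := by
  rw [Fintype.linearIndependent_iff]
  intro g hg i
  obtain ⟨c, hc⟩ := hker (Fin.cons 0 g) (by
    rw [Matrix.vecMul_eq_sum, Fin.sum_univ_succ]
    simpa using hg)
  have hc0 : c = 0 := by
    have := congrFun hc 0
    simpa [h0] using this.symm
  have := congrFun hc i.succ
  simpa [hc0] using this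

theorem isLatticeBasis_succ_rows {M : Matrix (Fin (n + 1)) (Fin (n + 1)) ℝ} {S : Fin (n + 1) → ℕ}
    (h0 : S 0 = 1)
    (hker : ∀ v : Fin (n + 1) → ℝ, v ᵥ* M = 0 ↔ ∃ c : ℝ, v = fun i => c * (S i : ℝ)) :
    IsLatticeBasis (M.submatrix Fin.succ id) (rowLattice M) := by
  have hS : (fun i => (S i : ℝ)) ᵥ* M = 0 := (hker fun i => (S i : ℝ)).2 ⟨1, by simp⟩
  have h0' : (S 0 : ℝ) ≠ 0 := by simp [h0]
  constructor
  · exact linearIndependent_succ_rows (S := fun i => (S i : ℝ)) h0' fun v => (hker v).1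
  · have h := closure_succ_rows (M := M) h0 hS
    have e : (fun i : Fin n => M i.succ) = fun i => M.submatrix Fin.succ id i := rfl
    rwa [e] at h

/-! ### The Schur test -/

/-- Cauchy–Schwarz with weights `|E i j|` uses the row sums; exchanging the order of summation then
uses the column sums. -/
theorem sum_mulVec_sq_le_of_abs_sum_le {m k : Type*} [Fintype m] [Fintype k]
    {E : Matrix m k ℝ} {δ : ℝ} (hδ : 0 ≤ δ) (hrow : ∀ i, ∑ j, |E i j| ≤ δ)
    (hcol : ∀ j, ∑ i, |E i j| ≤ δ) (v : k → ℝ) :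
    ∑ i, ((E *ᵥ v) i) ^ 2 ≤ δ ^ 2 * ∑ j, v j ^ 2 := by
  have hterm : ∀ i, ((E *ᵥ v) i) ^ 2 ≤ δ * ∑ j, |E i j| * (v j) ^ 2 := fun i => by
    have h1 : ((E *ᵥ v) i) ^ 2 ≤ (∑ j, |E i j|) * ∑ j, |E i j| * (v j) ^ 2 := by
      refine Finset.sum_sq_le_sum_mul_sum_of_sq_le_mul _ (fun j _ => abs_nonneg _)
        (fun j _ => by positivity) fun j _ => ?_
      rw [mul_pow, ← sq_abs (E i j)]
      refine le_of_eq ?_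
      ring
    exact h1.trans (mul_le_mul_of_nonneg_right (hrow i)
      (Finset.sum_nonneg fun j _ => by positivity))
  calc _ ≤ ∑ i, δ * ∑ j, |E i j| * (v j) ^ 2 := Finset.sum_le_sum fun i _ => hterm i
    _ = δ * ∑ j, (∑ i, |E i j|) * (v j) ^ 2 := by
        rw [← Finset.mul_sum, Finset.sum_comm]
        simp only [Finset.sum_mul]
    _ ≤ δ * ∑ j, δ * (v j) ^ 2 := by
        refine mul_le_mul_of_nonneg_left (Finset.sum_le_sum fun j _ => ?_) hδ
        exact mul_le_mul_of_nonneg_right (hcol j) (sq_nonneg _)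
    _ = _ := by
        rw [← Finset.mul_sum]
        ring

open scoped Matrix.Norms.L2Operator in
theorem l2_opNorm_le_of_abs_sum_le {m k : Type*} [Fintype m] [Fintype k] [DecidableEq k]
    {E : Matrix m k ℝ} {δ : ℝ} (hδ : 0 ≤ δ) (hrow : ∀ i, ∑ j, |E i j| ≤ δ)
    (hcol : ∀ j, ∑ i, |E i j| ≤ δ) : ‖E‖ ≤ δ := by
  rw [Matrix.l2_opNorm_def]
  refine ContinuousLinearMap.opNorm_le_bound _ hδ fun v => ?_
  refine (sq_le_sq₀ (norm_nonneg _) (mul_nonneg hδ (norm_nonneg _))).1 ?_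
  rw [mul_pow, EuclideanSpace.norm_sq_eq, EuclideanSpace.norm_sq_eq]
  simp only [Real.norm_eq_abs, sq_abs]
  exact sum_mulVec_sq_le_of_abs_sum_le hδ hrow hcol v.ofLp

/-! ### Firings of rational matrices -/

/-- The rational exponent vector `Qᵀ y`. -/
def ratFiring (Q : Matrix (Fin (n + 1)) (Fin (n + 1)) ℚ) (y : Fin (n + 1) → ℕ) :
    Fin (n + 1) → ℚ :=
  Qᵀ *ᵥ fun s => (y s : ℚ)

theorem ratFiring_add_smul (Q P : Matrix (Fin (n + 1)) (Fin (n + 1)) ℚ) (ε : ℚ)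
    (y : Fin (n + 1) → ℕ) (k : Fin (n + 1)) :
    ratFiring (Q + ε • P) y k = ratFiring Q y k + ε * ratFiring P y k := by
  simp [ratFiring, Matrix.add_mulVec, Matrix.smul_mulVec]

theorem cast_firing {Q : Matrix (Fin (n + 1)) (Fin (n + 1)) ℚ} {l : ℚ}
    {M : Matrix (Fin (n + 1)) (Fin (n + 1)) ℤ} (h : l • Q = M.map ((↑) : ℤ → ℚ))
    (y : Fin (n + 1) → ℕ) (k : Fin (n + 1)) : (firing M y k : ℚ) = l * ratFiring Q y k := by
  have h1 : ∀ i j, (M i j : ℚ) = l * Q i j := fun i j => by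
    have := congrFun (congrFun h i) j
    simpa using this.symm
  simp [firing, ratFiring, Matrix.mulVec, dotProduct, h1, Finset.mul_sum, mul_assoc]

theorem IsScaling.firing_eq_zero_iff {Q : Matrix (Fin (n + 1)) (Fin (n + 1)) ℚ} {l : ℚ}
    {M : Matrix (Fin (n + 1)) (Fin (n + 1)) ℤ} (h : IsScaling Q l M)
    (y : Fin (n + 1) → ℕ) (k : Fin (n + 1)) : firing M y k = 0 ↔ ratFiring Q y k = 0 := by
  rw [← Int.cast_eq_zero (α := ℚ), cast_firing h.2, mul_eq_zero]
  exact or_iff_right h.1.1.1.ne'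

/-- This is the rank-one factorisation: the outer product of `e_i / S i - e_j / S j` with `e_i -
e_j`. -/
theorem twoCycle_apply (S : Fin (n + 1) → ℕ) (i j a b : Fin (n + 1)) :
    twoCycle S i j a b = ((if a = i then 1 / (S i : ℚ) else 0) - if a = j then 1 / (S j : ℚ) else 0)
      * ((if b = i then 1 else 0) - if b = j then 1 else 0) := by
  simp only [twoCycle, laplacian_apply, Matrix.add_apply, Matrix.single_apply,
    Finset.sum_add_distrib, ite_and]
  simp only [Finset.sum_ite_irrel, Finset.sum_ite_eq, Finset.mem_univ, if_true, Finset.sum_const_zero]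
  by_cases h1 : a = i <;> by_cases h2 : a = j <;> by_cases h3 : b = i <;> by_cases h4 : b = j <;>
    simp_all [eq_comm]

theorem ratFiring_twoCycle (S : Fin (n + 1) → ℕ) (i j : Fin (n + 1)) (y : Fin (n + 1) → ℕ)
    (k : Fin (n + 1)) : ratFiring (twoCycle S i j) y k =
      ((if k = i then 1 else 0) - if k = j then 1 else 0) * ((y i : ℚ) / S i - (y j : ℚ) / S j) := by
  simp only [ratFiring, Matrix.mulVec, dotProduct, Matrix.transpose_apply, twoCycle_apply]
  simp only [sub_mul, mul_sub, ite_mul, mul_ite, mul_one, mul_zero, zero_mul, one_mul,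
    Finset.sum_sub_distrib, Finset.sum_ite_irrel, Finset.sum_ite_eq', Finset.mem_univ, if_true,
    Finset.sum_const_zero]
  split_ifs <;> ring

theorem le_oneNorm_twoCycle {S : Fin (n + 1) → ℕ} {i j : Fin (n + 1)} (hij : i ≠ j) :
    1 / (S i : ℚ) + 1 / (S j : ℚ) ≤ oneNorm (twoCycle S i j) := by
  refine le_trans ?_ (Finset.le_sup' (fun c => ∑ r, |twoCycle S i j r c|) (Finset.mem_univ i))
  refine le_trans (le_of_eq ?_) (Finset.sum_le_sum_of_subset_of_nonneg
    (Finset.subset_univ {i, j}) fun _ _ _ => abs_nonneg _)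
  rw [Finset.sum_pair hij]
  simp [twoCycle_apply, hij, hij.symm]

/-! ### The scaling factor -/

theorem exists_isScaling {Q : Matrix (Fin (n + 1)) (Fin (n + 1)) ℚ} (hQ : ∃ i j, Q i j ≠ 0) :
    ∃ l M, IsScaling Q l M := by
  obtain ⟨a, b, hab⟩ := hQ
  set s : Set ℚ := {t : ℚ | 0 < t ∧
    ∃ N : Matrix (Fin (n + 1)) (Fin (n + 1)) ℤ, t • Q = N.map ((↑) : ℤ → ℚ)} with hs
  have hne : ∃ t, t ∈ s := by
    have h : ∀ i j, ∃ z : ℤ, ((∏ i, ∏ j, (Q i j).den : ℕ) : ℚ) * Q i j = z := fun i j => by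
      obtain ⟨d, hd⟩ : (Q i j).den ∣ ∏ i, ∏ j, (Q i j).den :=
        (Finset.dvd_prod_of_mem (fun j => (Q i j).den) (Finset.mem_univ j)).trans
          (Finset.dvd_prod_of_mem (fun i => ∏ j, (Q i j).den) (Finset.mem_univ i))
      refine ⟨(Q i j).num * d, ?_⟩
      rw [hd, Nat.cast_mul, Int.cast_mul, Int.cast_natCast, ← Rat.mul_den_eq_num]
      ring
    choose N hN using h
    refine ⟨((∏ i, ∏ j, (Q i j).den : ℕ) : ℚ), ?_, Matrix.of N, ?_⟩
    · exact_mod_cast Finset.prod_pos fun i _ => Finset.prod_pos fun j _ => (Q i j).den_pos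
    · ext i j
      exact hN i j
  -- On admissible multiples `t`, the natural number `f t` equals `t * |Q a b|`, so minimising it
  -- minimises `t`.
  let f : ℚ → ℕ := fun t => (t * Q a b).num.natAbs
  obtain ⟨t, ht, hmin⟩ : ∃ t ∈ s, ∀ t' ∈ s, f t ≤ f t' := by
    obtain ⟨t, ht, hmin⟩ := (measure f).wf.has_min s hne
    exact ⟨t, ht, fun t' ht' => not_lt.1 (hmin t' ht')⟩
  have hf : ∀ t ∈ s, (f t : ℚ) = t * |Q a b| := by
    rintro t ⟨ht0, N, hN⟩
    have h1 : t * Q a b = N a b := by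
      have := congrFun (congrFun hN a) b
      simpa using this
    have h2 : f t = (N a b).natAbs := by simp [f, h1]
    rw [h2, Nat.cast_natAbs, Int.cast_abs, ← h1, abs_mul, abs_of_pos ht0]
  obtain ⟨M, hM⟩ := ht.2
  refine ⟨t, M, ⟨ht, fun t' ht' => ?_⟩, hM⟩
  have h1 : (f t : ℚ) ≤ f t' := by exact_mod_cast hmin t' ht'
  rw [hf t ht, hf t' ht'] at h1
  exact le_of_mul_le_mul_right h1 (abs_pos.2 hab)

/-! ### Admissible multiples -/

/-- The only multiple that could cancel a coordinate is minus the quotient of the two firings. It is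
positive only when they have opposite signs, and then admissibility puts `ε` strictly below it. -/
theorem IsAdmissible.ratFiring_ne_zero {S : Fin (n + 1) → ℕ} {δ : ℝ}
    {Q : Matrix (Fin (n + 1)) (Fin (n + 1)) ℚ} {i j : Fin (n + 1)} {ε : ℚ}
    (h : IsAdmissible S δ Q i j ε) {y : Fin (n + 1) → ℕ} (hy : y ≤ S) {k : Fin (n + 1)}
    (hk : ratFiring Q y k ≠ 0 ∨ ratFiring (twoCycle S i j) y k ≠ 0) :
    ratFiring (Q + ε • twoCycle S i j) y k ≠ 0 := by
  obtain ⟨h0, h1, -⟩ := h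
  rw [ratFiring_add_smul]
  intro hz
  by_cases hP : ratFiring (twoCycle S i j) y k = 0
  · rw [hP, mul_zero, add_zero] at hz
    exact hk.elim (fun h => h hz) fun h => h hP
  have hQ : ratFiring Q y k = -(ε * ratFiring (twoCycle S i j) y k) := by linarith
  have hij : k = i ∨ k = j := by
    by_contra! hne
    rw [ratFiring_twoCycle, if_neg hne.1, if_neg hne.2] at hP
    simp at hP
  have hneg : ratFiring (twoCycle S i j) y k * ratFiring Q y k < 0 := by
    rw [hQ]
    have := mul_pos h0 (mul_self_pos.2 hP)
    linarith
  have h2 := h1 y hy k hij hneg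
  change ε < -(ratFiring Q y k / ratFiring (twoCycle S i j) y k) at h2
  rw [hQ, neg_div, neg_neg, mul_div_cancel_right₀ _ hP] at h2
  exact lt_irrefl _ h2

theorem exists_isAdmissible {S : Fin (n + 1) → ℕ} (hS : ∀ i, 0 < S i) {δ : ℝ} (hδ : 0 < δ)
    (Q : Matrix (Fin (n + 1)) (Fin (n + 1)) ℚ) {i j : Fin (n + 1)} (hij : i ≠ j) :
    ∃ ε, IsAdmissible S δ Q i j ε := by
  have hD : 0 < δ / ((oneNorm (twoCycle S i j) : ℝ) * (n + 1) * ∏ s, (S s : ℝ)) := by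
    have h1 : (0 : ℚ) < oneNorm (twoCycle S i j) := by
      refine lt_of_lt_of_le ?_ (le_oneNorm_twoCycle hij)
      have := hS i
      have := hS j
      positivity
    have h2 : (0 : ℝ) < oneNorm (twoCycle S i j) := by exact_mod_cast h1
    have h3 : (0 : ℝ) < ∏ s, (S s : ℝ) := Finset.prod_pos fun s _ => by exact_mod_cast hS s
    positivity
  obtain ⟨ε₀, h₀, h₁⟩ := exists_rat_btwn hD
  -- Only finitely many positive thresholds occur; half of their minimum, taken together with a
  -- rational below the size bound, is admissible.
  set c : (Fin (n + 1) → ℕ) × Fin (n + 1) → ℚ := fun p =>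
    -(ratFiring Q p.1 p.2 / ratFiring (twoCycle S i j) p.1 p.2)
  set F := (Finset.Iic S ×ˢ (Finset.univ : Finset (Fin (n + 1)))).filter fun p => 0 < c p
  obtain ⟨ε, hε0, hε1⟩ : ∃ ε : ℚ, 0 < ε ∧ ∀ t ∈ insert ε₀ (F.image c), ε < t := by
    obtain ⟨m, hm, hmin⟩ := Finset.exists_min_image (insert ε₀ (F.image c)) id
      (Finset.insert_nonempty _ _)
    have hm0 : 0 < m := by
      rcases Finset.mem_insert.1 hm with rfl | hm
      · exact_mod_cast h₀
      · obtain ⟨p, hp, rfl⟩ := Finset.mem_image.1 hm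
        exact (Finset.mem_filter.1 hp).2
    exact ⟨m / 2, by linarith, fun t ht => by
      have : m ≤ t := hmin t ht
      linarith⟩
  refine ⟨ε, hε0, fun y hy k _ hneg => ?_, ?_⟩
  · refine hε1 (c (y, k)) (Finset.mem_insert_of_mem (Finset.mem_image_of_mem _ ?_))
    refine Finset.mem_filter.2 ⟨by simp [hy], ?_⟩
    change ratFiring (twoCycle S i j) y k * ratFiring Q y k < 0 at hneg
    change 0 < -(ratFiring Q y k / ratFiring (twoCycle S i j) y k)
    rw [neg_pos]
    exact div_neg_iff.2 ((mul_neg_iff.1 hneg).symm.imp And.symm And.symm)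
  · refine lt_trans ?_ h₁
    exact_mod_cast hε1 ε₀ (Finset.mem_insert_self _ _)

/-! ### Termination -/

/-- The pairs of a firing `y ≤ S` and a coordinate at which `Qᵀ y` vanishes. -/
def zeroPairs (S : Fin (n + 1) → ℕ) (Q : Matrix (Fin (n + 1)) (Fin (n + 1)) ℚ) :
    Finset ((Fin (n + 1) → ℕ) × Fin (n + 1)) :=
  (Finset.Iic S ×ˢ Finset.univ).filter fun p => ratFiring Q p.1 p.2 = 0

theorem ratFiring_twoCycle_ne_zero {S : Fin (n + 1) → ℕ} {i j : Fin (n + 1)}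
    {y : Fin (n + 1) → ℕ} (h : (y j : ℚ) / S j ≠ (y i : ℚ) / S i) {k : Fin (n + 1)}
    (hk : k = i ∨ k = j) : ratFiring (twoCycle S i j) y k ≠ 0 := by
  have hij : i ≠ j := by
    rintro rfl
    exact h rfl
  rw [ratFiring_twoCycle]
  refine mul_ne_zero ?_ (sub_ne_zero.2 h.symm)
  rcases hk with rfl | rfl
  · simp [hij]
  · simp [hij.symm]

/-- No new zero is created, and the pair `(x, i)` is lost because the two-cycle acts nontrivially on
it. -/
theorem card_zeroPairs_lt_of_step {S : Fin (n + 1) → ℕ} {δ : ℝ}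
    {Q Q' : Matrix (Fin (n + 1)) (Fin (n + 1)) ℚ} (h : Step S δ Q Q') :
    (zeroPairs S Q').card < (zeroPairs S Q).card := by
  obtain ⟨l, M, hM, x, i, j, ε, ⟨-, hxS, hx⟩, hij, hε, rfl⟩ := h
  refine Finset.card_lt_card (Finset.ssubset_iff_of_subset ?_ |>.2 ⟨(x, i), ?_, ?_⟩)
  · intro p hp
    simp only [zeroPairs, Finset.mem_filter, Finset.mem_product, Finset.mem_Iic, Finset.mem_univ,
      and_true] at hp ⊢
    refine ⟨hp.1, ?_⟩
    by_contra hne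
    exact hε.ratFiring_ne_zero hp.1 (Or.inl hne) hp.2
  · simpa [zeroPairs, hxS.le] using (hM.firing_eq_zero_iff x i).1 hx
  · simpa [zeroPairs, hxS.le] using hε.ratFiring_ne_zero hxS.le
      (Or.inr (ratFiring_twoCycle_ne_zero hij (Or.inl rfl)))

theorem not_exists_infinite_run {S : Fin (n + 1) → ℕ} {δ : ℝ}
    (run : ℕ → Matrix (Fin (n + 1)) (Fin (n + 1)) ℚ) : ¬ ∀ r, Step S δ (run r) (run (r + 1)) := by
  intro h
  have key : ∀ r, (zeroPairs S (run r)).card + r ≤ (zeroPairs S (run 0)).card := by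
    intro r
    induction r with
    | zero => simp
    | succ r ih =>
      have := card_zeroPairs_lt_of_step (h r)
      omega
  have := key ((zeroPairs S (run 0)).card + 1)
  omega

/-! ### The matrices reached by the algorithm -/

/-- The weight matrix `e i j / S i`. -/
def scaledWeights (S : Fin (n + 1) → ℕ) (e : Matrix (Fin (n + 1)) (Fin (n + 1)) ℚ) :
    Matrix (Fin (n + 1)) (Fin (n + 1)) ℚ :=
  Matrix.of fun i j => e i j / S i

/-- `Q` arises from the Laplacian of `A` by adding two-cycles with symmetric multiplicities `e` of
bounded size, and no pair with nonzero multiplicity can be used by the algorithm again. -/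
structure IsDeformation (A : Matrix (Fin (n + 1)) (Fin (n + 1)) ℕ) (S : Fin (n + 1) → ℕ) (δ : ℝ)
    (e Q : Matrix (Fin (n + 1)) (Fin (n + 1)) ℚ) : Prop where
  eq_laplacian : Q = laplacian (A.map ((↑) : ℕ → ℚ) + scaledWeights S e)
  symm : ∀ i j, e i j = e j i
  diag : ∀ i, e i i = 0
  nonneg : ∀ i j, 0 ≤ e i j
  bound : ∀ i j, (e i j : ℝ) * ((1 / S i + 1 / S j) * ((n + 1) * ∏ s, (S s : ℝ))) ≤ δ
  resolved : ∀ i j, e i j ≠ 0 → ∀ y ≤ S, (y j : ℚ) / S j ≠ (y i : ℚ) / S i → ratFiring Q y i ≠ 0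

theorem isDeformation_zero (A : Matrix (Fin (n + 1)) (Fin (n + 1)) ℕ) (S : Fin (n + 1) → ℕ) {δ : ℝ}
    (hδ : 0 < δ) : IsDeformation A S δ 0 (laplacian (A.map ((↑) : ℕ → ℚ))) where
  eq_laplacian := by
    congr 1
    ext i j
    simp [scaledWeights]
  symm := by simp
  diag := by simp
  nonneg := by simp
  bound := by simp [hδ.le]
  resolved := by simp

/-- The chosen pair has not been used before, since `resolved` would contradict the defect. Its
multiplicity therefore goes from `0` to exactly `ε`, and a single admissibility bound suffices. -/
theorem IsDeformation.exists_of_step {A : Matrix (Fin (n + 1)) (Fin (n + 1)) ℕ}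
    {S : Fin (n + 1) → ℕ} {δ : ℝ} {e Q Q' : Matrix (Fin (n + 1)) (Fin (n + 1)) ℚ}
    (hS : ∀ i, 0 < S i) (h : IsDeformation A S δ e Q) (hstep : Step S δ Q Q') :
    ∃ e', IsDeformation A S δ e' Q' := by
  obtain ⟨l, M, hM, x, i, j, ε, ⟨-, hxS, hx⟩, hx_ne, hε, rfl⟩ := hstep
  have hij : i ≠ j := by
    rintro rfl
    exact hx_ne rfl
  have he : e i j = 0 := by
    by_contra hne
    exact h.resolved i j hne x hxS.le hx_ne ((hM.firing_eq_zero_iff x i).1 hx)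
  have hprod : (0 : ℝ) < ∏ s, (S s : ℝ) := Finset.prod_pos fun s _ => by exact_mod_cast hS s
  have hpos : (0 : ℝ) < 1 / S i + 1 / S j := by
    have := hS i
    have := hS j
    positivity
  have hbound : (ε : ℝ) * ((1 / S i + 1 / S j) * ((n + 1) * ∏ s, (S s : ℝ))) ≤ δ := by
    have h1 : (1 / S i + 1 / S j : ℝ) ≤ oneNorm (twoCycle S i j) := by
      have := (Rat.cast_le (K := ℝ)).2 (le_oneNorm_twoCycle (S := S) hij)
      push_cast at this
      exact this
    have hε0 : (0 : ℝ) < ε := by exact_mod_cast hε.1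
    have h2 := (lt_div_iff₀ (by have := hpos.trans_le h1; positivity)).1 hε.2.2
    rw [mul_assoc] at h2
    refine le_trans ?_ h2.le
    gcongr
  -- As `e i j` and `e j i` vanish, adding `ε` amounts to overwriting.
  have hval : ∀ a b, (e + ε • (Matrix.single i j 1 + Matrix.single j i 1) :
      Matrix (Fin (n + 1)) (Fin (n + 1)) ℚ) a b =
      if (a = i ∧ b = j) ∨ (a = j ∧ b = i) then ε else e a b := fun a b => by
    have he' : e j i = 0 := by rw [h.symm, he]
    simp only [Matrix.add_apply, Matrix.smul_apply, Matrix.single_apply, smul_eq_mul]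
    by_cases h1 : a = i ∧ b = j
    · obtain ⟨rfl, rfl⟩ := h1
      simp [he, hij]
    · by_cases h2 : a = j ∧ b = i
      · obtain ⟨rfl, rfl⟩ := h2
        simp [he', hij]
      · have h1' : ¬ (i = a ∧ j = b) := fun h => h1 ⟨h.1.symm, h.2.symm⟩
        have h2' : ¬ (j = a ∧ i = b) := fun h => h2 ⟨h.1.symm, h.2.symm⟩
        simp [h1, h2, h1', h2']
  refine ⟨e + ε • (Matrix.single i j 1 + Matrix.single j i 1), ?_, ?_, ?_, ?_, ?_, ?_⟩
  · rw [h.eq_laplacian, twoCycle, ← laplacian_smul, ← laplacian_add, add_assoc]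
    congr 2
    ext a b
    simp only [scaledWeights, Matrix.add_apply, Matrix.smul_apply, Matrix.single_apply,
      Matrix.of_apply, smul_eq_mul]
    by_cases h1 : i = a <;> by_cases h2 : j = a <;> simp [h1, h2, add_div]
    · subst h1
      split_ifs <;> ring
    · subst h1
      split_ifs <;> ring
    · subst h2
      split_ifs <;> ring
  · intro a b
    rw [hval, hval, h.symm a b]
    congr 1
    exact propext ⟨fun h => h.symm.imp And.symm And.symm, fun h => h.symm.imp And.symm And.symm⟩
  · intro a
    rw [hval, if_neg, h.diag]
    rintro (⟨rfl, h⟩ | ⟨rfl, h⟩)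
    · exact hij h
    · exact hij h.symm
  · intro a b
    rw [hval]
    split_ifs
    · exact hε.1.le
    · exact h.nonneg a b
  · intro a b
    rw [hval]
    split_ifs with hc
    · rcases hc with ⟨rfl, rfl⟩ | ⟨rfl, rfl⟩
      · exact hbound
      · rwa [add_comm (1 / (S a : ℝ))]
    · exact h.bound a b
  · intro a b
    rw [hval]
    split_ifs with hc
    · rintro - y hy hne
      refine hε.ratFiring_ne_zero hy (Or.inr ?_)
      rcases hc with ⟨rfl, rfl⟩ | ⟨rfl, rfl⟩
      · exact ratFiring_twoCycle_ne_zero hne (Or.inl rfl)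
      · exact ratFiring_twoCycle_ne_zero hne.symm (Or.inr rfl)
    · intro hne y hy hy'
      exact hε.ratFiring_ne_zero hy (Or.inl (h.resolved a b hne y hy hy'))

theorem exists_isDeformation_of_run {A : Matrix (Fin (n + 1)) (Fin (n + 1)) ℕ}
    {S : Fin (n + 1) → ℕ} {δ : ℝ} (hδ : 0 < δ) (hS : ∀ i, 0 < S i)
    {Q : Matrix (Fin (n + 1)) (Fin (n + 1)) ℚ}
    (h : Relation.ReflTransGen (Step S δ) (laplacian (A.map ((↑) : ℕ → ℚ))) Q) :
    ∃ e, IsDeformation A S δ e Q := by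
  induction h with
  | refl => exact ⟨0, isDeformation_zero A S hδ⟩
  | tail _ hstep ih =>
    obtain ⟨e, he⟩ := ih
    exact he.exists_of_step hS hstep

/-! ### Invariants of a deformation: left kernel, basis, distance, digraph -/

section Deformation

variable {A : Matrix (Fin (n + 1)) (Fin (n + 1)) ℕ} {S : Fin (n + 1) → ℕ} {δ : ℝ}
  {e Q : Matrix (Fin (n + 1)) (Fin (n + 1)) ℚ}

theorem IsDeformation.weight_nonneg (h : IsDeformation A S δ e Q) (i j : Fin (n + 1)) :
    0 ≤ scaledWeights S e i j :=
  div_nonneg (h.nonneg i j) (Nat.cast_nonneg _)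

theorem IsDeformation.apply_ne (h : IsDeformation A S δ e Q) {i j : Fin (n + 1)} (hij : i ≠ j) :
    Q i j = -(A i j + scaledWeights S e i j) := by
  rw [h.eq_laplacian, laplacian_apply, if_neg hij, zero_sub]
  rfl

theorem IsDeformation.apply_nonpos (h : IsDeformation A S δ e Q) {i j : Fin (n + 1)}
    (hij : i ≠ j) : Q i j ≤ 0 := by
  rw [h.apply_ne hij]
  have := h.weight_nonneg i j
  have : (0 : ℚ) ≤ A i j := Nat.cast_nonneg _
  linarith

theorem IsDeformation.apply_neg (h : IsDeformation A S δ e Q) {i j : Fin (n + 1)}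
    (hij : i ≠ j) (hA : 0 < A i j) : Q i j < 0 := by
  rw [h.apply_ne hij]
  have := h.weight_nonneg i j
  have : (0 : ℚ) < A i j := Nat.cast_pos.2 hA
  linarith

/-- The factor `S i` cancels the denominator of the weight `e i j / S i`, so the added graph carries
flow `e i j` along each edge; symmetry of `e` balances inflow and outflow. -/
theorem IsDeformation.vecMul_eq_zero {L : AddSubgroup (Fin (n + 1) → ℤ)}
    (hp : IsPreprocessed L A S) (h : IsDeformation A S δ e Q) :
    (fun i => (S i : ℚ)) ᵥ* Q = 0 := by
  have h1 : (fun i => (S i : ℚ)) ᵥ* laplacian (A.map ((↑) : ℕ → ℚ)) = 0 :=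
    (hp.kernel _).2 ⟨1, by simp⟩
  rw [h.eq_laplacian, laplacian_add, Matrix.vecMul_add, h1, zero_add,
    ← Matrix.mulVec_transpose]
  funext k
  have hS : ∀ i, (S i : ℚ) ≠ 0 := fun i => Nat.cast_ne_zero.2 (hp.pos i).ne'
  rw [transpose_laplacian_mulVec, Finset.mul_sum, ← Finset.sum_sub_distrib]
  refine Finset.sum_eq_zero fun s _ => ?_
  simp only [scaledWeights, Matrix.of_apply]
  rw [mul_div_cancel₀ _ (hS k), mul_div_cancel₀ _ (hS s), h.symm, sub_self]

theorem IsDeformation.spansLeftKernel {L : AddSubgroup (Fin (n + 1) → ℤ)}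
    (hp : IsPreprocessed L A S) (h : IsDeformation A S δ e Q) : SpansLeftKernel Q S :=
  vecMul_eq_zero_iff_of_stronglyConnected (fun i => Nat.cast_pos.2 (hp.pos i))
    (h.vecMul_eq_zero hp) (fun _ _ hij => h.apply_nonpos hij)
    (fun _ _ hA hij => h.apply_neg hij hA) hp.stronglyConnected

theorem IsDeformation.isLatticeBasis {L : AddSubgroup (Fin (n + 1) → ℤ)}
    (hp : IsPreprocessed L A S) (h : IsDeformation A S δ e Q) :
    IsLatticeBasis ((Q.map ((↑) : ℚ → ℝ)).submatrix Fin.succ id)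
      (rowLattice (Q.map ((↑) : ℚ → ℝ))) := by
  refine isLatticeBasis_succ_rows hp.zero (vecMul_eq_zero_iff_of_stronglyConnected
    (fun i => Nat.cast_pos.2 (hp.pos i)) ?_ (fun i j hij => ?_) (fun i j hA hij => ?_)
    hp.stronglyConnected)
  · funext k
    have h1 := congrFun (h.vecMul_eq_zero hp) k
    simp only [Matrix.vecMul, dotProduct, Pi.zero_apply] at h1
    simp only [Matrix.vecMul, dotProduct, Pi.zero_apply, Matrix.map_apply]
    exact_mod_cast h1
  · exact Rat.cast_nonpos.2 (h.apply_nonpos hij)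
  · exact Rat.cast_lt_zero.2 (h.apply_neg hij hA)

theorem IsDeformation.weight_le (h : IsDeformation A S δ e Q) (hδ : 0 < δ) (hS : ∀ i, 0 < S i)
    (i j : Fin (n + 1)) : 2 * (scaledWeights S e i j : ℝ) ≤ δ / (n + 1) ∧
      (scaledWeights S e i j : ℝ) + scaledWeights S e j i ≤ δ / (n + 1) := by
  have hd : 0 ≤ δ / (n + 1) := by positivity
  by_cases hij : i = j
  · subst hij
    simp [scaledWeights, h.diag, hd]
  have hb := h.bound i j
  have he : (0 : ℝ) ≤ e i j := by exact_mod_cast h.nonneg i j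
  have hS1 : ∀ i, (1 : ℝ) ≤ S i := fun i => by exact_mod_cast hS i
  have hi := hS1 i
  have hj := hS1 j
  -- This trades the product in the size bound for `S i * S j`, and `(1 / S i + 1 / S j) * (S i * S
  -- j) = S i + S j ≥ 2` gives `2 * e i j ≤ δ / (n + 1)`.
  have hP : (S i : ℝ) * S j ≤ ∏ s, (S s : ℝ) := by
    rw [← Finset.prod_pair (f := fun s => (S s : ℝ)) hij]
    exact Finset.prod_le_prod_of_subset_of_one_le (Finset.subset_univ _)
      (fun s _ => by positivity) fun s _ _ => hS1 s
  have hb' : (e i j : ℝ) * (1 / S i + 1 / S j) * (∏ s, (S s : ℝ)) ≤ δ / (n + 1) := by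
    rw [le_div_iff₀ (by positivity)]
    linarith
  have hb'' : (e i j : ℝ) * (S i + S j) ≤ δ / (n + 1) := by
    refine le_trans ?_ hb'
    have : (e i j : ℝ) * (S i + S j) = (e i j : ℝ) * (1 / S i + 1 / S j) * (S i * S j) := by
      field_simp
      ring
    rw [this]
    gcongr
  have hle : ∀ k, (e i j : ℝ) / S k ≤ e i j := fun k => div_le_self he (hS1 k)
  have h1 := hle i
  have h2 := hle j
  have h3 : (e i j : ℝ) * 2 ≤ e i j * (S i + S j) := by gcongr; linarith
  simp only [scaledWeights, Matrix.of_apply, ← h.symm i j]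
  push_cast
  constructor <;> linarith

open scoped Matrix.Norms.L2Operator in
-- The difference is the Laplacian of the added weights. Each absolute row or column sum is at most
-- a sum of `n + 1` terms bounded by `IsDeformation.weight_le`, so the Schur test applies; omitting
-- row `0` only lowers column sums.
theorem IsDeformation.norm_le (h : IsDeformation A S δ e Q) (hδ : 0 < δ) (hS : ∀ i, 0 < S i) :
    ‖(Q.map ((↑) : ℚ → ℝ)).submatrix (Fin.succ : Fin n → Fin (n + 1)) id -
      ((laplacian (A.map ((↑) : ℕ → ℚ))).map ((↑) : ℚ → ℝ)).submatrix Fin.succ id‖ ≤ δ := by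
  set g : Matrix (Fin (n + 1)) (Fin (n + 1)) ℝ := (scaledWeights S e).map ((↑) : ℚ → ℝ) with hg
  have hE : Q.map ((↑) : ℚ → ℝ) - (laplacian (A.map ((↑) : ℕ → ℚ))).map ((↑) : ℚ → ℝ) =
      laplacian g := by
    have : g = (scaledWeights S e).map (Rat.castHom ℝ) := rfl
    rw [this, laplacian_map, h.eq_laplacian, laplacian_add]
    ext i j
    simp
  have hEa : ∀ i j, (Q.map ((↑) : ℚ → ℝ)) i j -
      ((laplacian (A.map ((↑) : ℕ → ℚ))).map ((↑) : ℚ → ℝ)) i j = laplacian g i j := fun i j =>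
    congrFun (congrFun hE i) j
  have hg0 : ∀ i j, 0 ≤ g i j := fun i j => Rat.cast_nonneg.2 (h.weight_nonneg i j)
  have habs : ∀ i j, |laplacian g i j| ≤ (if i = j then ∑ k, g i k else 0) + g i j := fun i j => by
    rw [laplacian_apply]
    refine (abs_sub _ _).trans ?_
    rw [abs_of_nonneg (hg0 i j), abs_of_nonneg]
    split_ifs
    · exact Finset.sum_nonneg fun k _ => hg0 i k
    · exact le_rfl
  have hconst : ∑ _k : Fin (n + 1), δ / (n + 1) = δ := by
    rw [Finset.sum_const, Finset.card_univ, Fintype.card_fin, nsmul_eq_mul]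
    push_cast
    field_simp
  refine l2_opNorm_le_of_abs_sum_le hδ.le (fun i => ?_) fun j => ?_
  · simp only [Matrix.sub_apply, Matrix.submatrix_apply, id, hEa]
    calc ∑ j, |laplacian g i.succ j| ≤
        ∑ j, ((if i.succ = j then ∑ k, g i.succ k else 0) + g i.succ j) :=
          Finset.sum_le_sum fun j _ => habs _ j
      _ = ∑ j, 2 * g i.succ j := by
          rw [Finset.sum_add_distrib, Finset.sum_ite_eq, if_pos (Finset.mem_univ _),
            ← Finset.mul_sum, two_mul]
      _ ≤ ∑ _k : Fin (n + 1), δ / (n + 1) := Finset.sum_le_sum fun j _ => (h.weight_le hδ hS _ j).1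
      _ = δ := hconst
  · simp only [Matrix.sub_apply, Matrix.submatrix_apply, id, hEa]
    calc ∑ i : Fin n, |laplacian g i.succ j| ≤ ∑ i, |laplacian g i j| := by
          rw [Fin.sum_univ_succ]
          exact le_add_of_nonneg_left (abs_nonneg _)
      _ ≤ ∑ i, ((if i = j then ∑ k, g i k else 0) + g i j) :=
          Finset.sum_le_sum fun i _ => habs i j
      _ = ∑ k, (g j k + g k j) := by
          rw [Finset.sum_add_distrib, Finset.sum_ite_eq', if_pos (Finset.mem_univ _),
            Finset.sum_add_distrib]
      _ ≤ ∑ _k : Fin (n + 1), δ / (n + 1) := Finset.sum_le_sum fun k _ => (h.weight_le hδ hS j k).2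
      _ = δ := hconst

/-- Any integral positive multiple of a deformation is the Laplacian of a strongly connected
multidigraph. -/
theorem IsDeformation.exists_multidigraph (h : IsDeformation A S δ e Q)
    (hA : StronglyConnected A) {l : ℚ} (hl : 0 < l) {M : Matrix (Fin (n + 1)) (Fin (n + 1)) ℤ}
    (hM : l • Q = M.map ((↑) : ℤ → ℚ)) :
    ∃ A' : Matrix (Fin (n + 1)) (Fin (n + 1)) ℕ,
      M = laplacian (A'.map ((↑) : ℕ → ℤ)) ∧ StronglyConnected A' := by
  have hMa : ∀ i j, (M i j : ℚ) = l * Q i j := fun i j => (congrFun (congrFun hM i) j).symm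
  have hoff : ∀ i j, i ≠ j → M i j ≤ 0 := fun i j hij => by
    have : (M i j : ℚ) ≤ 0 := by
      rw [hMa]
      exact mul_nonpos_of_nonneg_of_nonpos hl.le (h.apply_nonpos hij)
    exact_mod_cast this
  refine ⟨Matrix.of fun i j => (-M i j).toNat, eq_laplacian_of_row_sum (fun i => ?_)
    (fun i j hij => ?_), fun u v => ?_⟩
  · have : ∑ j, (M i j : ℚ) = 0 := by
      simp only [hMa, ← Finset.mul_sum]
      rw [h.eq_laplacian, laplacian_row_sum, mul_zero]
    exact_mod_cast this
  · have := hoff i j hij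
    simp only [Matrix.map_apply, Matrix.of_apply]
    omega
  · induction hA u v with
    | refl => exact Relation.ReflTransGen.refl
    | @tail b c _ hbc ih =>
      by_cases hne : b = c
      · rwa [← hne]
      refine ih.tail ?_
      have h1 : (M b c : ℚ) < 0 := by
        rw [hMa]
        exact mul_neg_of_pos_of_neg hl (h.apply_neg hne hbc)
      have h2 : M b c < 0 := by exact_mod_cast h1
      simp only [Matrix.of_apply]
      omega

/-- With at least two vertices, strong connectivity forces an edge that is not a loop. This is what
makes the scaling factor exist. -/
theorem IsDeformation.exists_ne_zero (h : IsDeformation A S δ e Q) (hA : StronglyConnected A)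
    (hn : 1 ≤ n) : ∃ i j, Q i j ≠ 0 := by
  by_contra! h0
  have key : ∀ u v, Relation.ReflTransGen (fun a b => 0 < A a b) u v → u = v := by
    intro u v huv
    induction huv with
    | refl => rfl
    | @tail b c _ hbc ih =>
      by_contra hne
      exact (h.apply_neg (fun hb : b = c => hne (ih.trans hb)) hbc).ne (h0 b c)
  have := key 0 (Fin.last n) (hA _ _)
  rw [Fin.ext_iff] at this
  simp at this
  omega

end Deformation

/-! ### Class sums of polynomials in a lattice ideal -/

section ClassSum

variable {𝕜 : Type*} [Field 𝕜]

open Classical in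
/-- The sum of the coefficients of the monomials whose exponent is congruent to `c` modulo `L`. -/
noncomputable def classSum (L : AddSubgroup (Fin (n + 1) → ℤ)) (c : Fin (n + 1) → ℤ) :
    MvPolynomial (Fin (n + 1)) 𝕜 →ₗ[𝕜] 𝕜 :=
  (basisMonomials (Fin (n + 1)) 𝕜).constr 𝕜 fun m =>
    if (fun k => (m k : ℤ)) - c ∈ L then (1 : 𝕜) else 0

open Classical in
theorem classSum_monomial (L : AddSubgroup (Fin (n + 1) → ℤ)) (c : Fin (n + 1) → ℤ)
    (m : Fin (n + 1) →₀ ℕ) (r : 𝕜) :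
    classSum L c (monomial m r) = if (fun k => (m k : ℤ)) - c ∈ L then r else 0 := by
  have h1 : (monomial m r : MvPolynomial (Fin (n + 1)) 𝕜) =
      r • basisMonomials (Fin (n + 1)) 𝕜 m := by
    simp [smul_monomial]
  rw [h1, map_smul, classSum, Module.Basis.constr_basis]
  simp

theorem classSum_monomial_mul (L : AddSubgroup (Fin (n + 1) → ℤ)) (c : Fin (n + 1) → ℤ)
    (m : Fin (n + 1) →₀ ℕ) (r : 𝕜) (f : MvPolynomial (Fin (n + 1)) 𝕜) :
    classSum L c (monomial m r * f) = r * classSum L (c - fun k => (m k : ℤ)) f := by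
  induction f using MvPolynomial.induction_on' with
  | monomial m' r' =>
    rw [monomial_mul, classSum_monomial, classSum_monomial]
    have : ((fun k => ((m + m') k : ℤ)) - c : Fin (n + 1) → ℤ) =
        (fun k => (m' k : ℤ)) - (c - fun k => (m k : ℤ)) := by
      funext k
      simp
      ring
    rw [this, mul_ite, mul_zero]
  | add p q hp hq => rw [mul_add, map_add, map_add, hp, hq, mul_add]

open Classical in
-- The two monomials of a generator lie in the same class, and multiplication by a monomial permutes
-- the classes; hence the induction has to treat all `c` at once.
theorem classSum_eq_zero_of_mem {L : AddSubgroup (Fin (n + 1) → ℤ)}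
    {f : MvPolynomial (Fin (n + 1)) 𝕜} (hf : f ∈ latticeIdeal 𝕜 L) (c : Fin (n + 1) → ℤ) :
    classSum L c f = 0 := by
  revert c
  induction hf using Submodule.span_induction with
  | mem f hf =>
    obtain ⟨a, b, hab, rfl⟩ := hf
    intro c
    rw [map_sub, classSum_monomial, classSum_monomial, sub_eq_zero]
    refine if_congr ?_ rfl rfl
    have : (fun k => (a k : ℤ)) - c = (fun k => (a k : ℤ) - (b k : ℤ)) + ((fun k => (b k : ℤ)) - c) := by
      funext k
      simp
    rw [this]
    exact L.add_mem_cancel_left hab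
  | zero => simp
  | add f g _ _ hf hg => simp [hf, hg]
  | smul p f _ hf =>
    intro c
    rw [smul_eq_mul, p.as_sum, Finset.sum_mul, map_sum]
    exact Finset.sum_eq_zero fun m _ => by rw [classSum_monomial_mul, hf, mul_zero]

/-- A monomial of a polynomial in the lattice ideal is congruent to another one. -/
theorem exists_ne_mem_support {L : AddSubgroup (Fin (n + 1) → ℤ)}
    {f : MvPolynomial (Fin (n + 1)) 𝕜} (hf : f ∈ latticeIdeal 𝕜 L) {a : Fin (n + 1) →₀ ℕ}
    (ha : a ∈ f.support) : ∃ b ∈ f.support, b ≠ a ∧ (fun k => (a k : ℤ) - (b k : ℤ)) ∈ L := by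
  classical
  by_contra! h
  have h1 := classSum_eq_zero_of_mem hf fun k => (a k : ℤ)
  rw [f.as_sum, map_sum, Finset.sum_eq_single_of_mem a ha, classSum_monomial, sub_self,
    if_pos L.zero_mem] at h1
  · exact mem_support_iff.1 ha h1
  · intro b hb hba
    rw [classSum_monomial, if_neg]
    intro hL
    refine h b hb hba ?_
    convert L.neg_mem hL using 1
    funext k
    simp

end ClassSum

/-! ### Legal firings -/

section Firing

variable {A : Matrix (Fin (n + 1)) (Fin (n + 1)) ℕ} {S : Fin (n + 1) → ℕ}

/-- A vertex loses chips only by its own firings and gains them from those of others, so more firing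
elsewhere can only lower its net loss. -/
theorem fire_le_of_le {x y : Fin (n + 1) → ℤ} (hxy : y ≤ x) {k : Fin (n + 1)} (hk : y k = x k) :
    ((laplacian (A.map ((↑) : ℕ → ℤ)))ᵀ *ᵥ x) k ≤ ((laplacian (A.map ((↑) : ℕ → ℤ)))ᵀ *ᵥ y) k := by
  rw [transpose_laplacian_mulVec, transpose_laplacian_mulVec, hk]
  refine sub_le_sub_left (Finset.sum_le_sum fun s _ => ?_) _
  exact mul_le_mul_of_nonneg_right (hxy s) (Int.natCast_nonneg _)

theorem sum_fire (y : Fin (n + 1) → ℤ) :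
    ∑ k, ((laplacian (A.map ((↑) : ℕ → ℤ)))ᵀ *ᵥ y) k = 0 := by
  simp only [Matrix.mulVec, dotProduct, Matrix.transpose_apply]
  rw [Finset.sum_comm]
  simp [← Finset.sum_mul, laplacian_row_sum]

/-- The top layer of a firing `σ` that is not nonpositive is legal whenever `σ` is. -/
theorem exists_legal_layer (hS : ∀ i, 0 < S i)
    (hMS : (laplacian (A.map ((↑) : ℕ → ℤ)))ᵀ *ᵥ (fun i => (S i : ℤ)) = 0)
    {σ : Fin (n + 1) → ℤ} (hσ : ∃ k, 0 < σ k) {a : Fin (n + 1) →₀ ℕ}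
    (ha : ∀ k, ((laplacian (A.map ((↑) : ℕ → ℤ)))ᵀ *ᵥ σ) k ≤ a k) :
    ∃ x : Fin (n + 1) → ℕ, x ≤ S ∧ (∃ k, 0 < x k) ∧ (∀ k, (x k : ℤ) ≤ max (σ k) 0) ∧
      ∀ k, firing (laplacian (A.map ((↑) : ℕ → ℤ))) x k ≤ a k := by
  classical
  have hex : ∃ m : ℕ, ∀ k, σ k ≤ (m + 1) * S k := by
    refine ⟨∑ i, (σ i).natAbs, fun k => ?_⟩
    have h1 : (σ k).natAbs ≤ ∑ i, (σ i).natAbs :=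
      Finset.single_le_sum (f := fun i => (σ i).natAbs) (fun _ _ => Nat.zero_le _)
        (Finset.mem_univ k)
    have h2 : (1 : ℤ) ≤ S k := by exact_mod_cast hS k
    have h3 : σ k ≤ (∑ i, (σ i).natAbs : ℕ) := by omega
    nlinarith
  -- With the least such `m`, the top layer `(σ - m S)⁺` is bounded by `S` and is not zero.
  obtain ⟨m, hm, hmin⟩ : ∃ m : ℕ, (∀ k, σ k ≤ (m + 1) * S k) ∧ ∃ k, m * S k < σ k := by
    refine ⟨Nat.find hex, Nat.find_spec hex, ?_⟩
    rcases hm0 : Nat.find hex with _ | m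
    · simpa using hσ
    · have := Nat.find_min hex (m := m) (by omega)
      push Not at this
      simpa using this
  have hcast : ∀ k, (((σ k - m * S k).toNat : ℕ) : ℤ) = max (σ k - m * S k) 0 := fun k =>
    Int.toNat_eq_max _
  have hmS : ∀ k, (0 : ℤ) ≤ m * S k := fun k => by positivity
  refine ⟨fun k => (σ k - m * S k).toNat, fun k => ?_, ?_, fun k => ?_, fun k => ?_⟩
  · have := hm k
    change (σ k - m * S k).toNat ≤ S k
    have h1 : ((m : ℤ) + 1) * S k = m * S k + S k := by ring
    omega
  · obtain ⟨k, hk⟩ := hmin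
    exact ⟨k, by simp only; omega⟩
  · rw [hcast]
    exact max_le_max (by linarith [hmS k]) le_rfl
  · rw [firing]
    simp only [hcast]
    -- Where the layer is not truncated, compare with `σ - m S`, which has the same effect as `σ`
    -- because `S` fires trivially. Where it is truncated to `0`, compare with firing nothing.
    rcases le_total 0 (σ k - m * S k) with h | h
    · refine le_trans (fire_le_of_le (y := σ - (m : ℤ) • fun i => (S i : ℤ)) (fun i => ?_) ?_) ?_
      · simp
      · simp [max_eq_left h]
      · rw [Matrix.mulVec_sub, Matrix.mulVec_smul, hMS, smul_zero, sub_zero]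
        exact ha k
    · refine le_trans (fire_le_of_le (y := 0) (fun i => ?_) ?_) ?_
      · simp
      · simp [max_eq_right h]
      · simp

theorem posExponent_le {u : Fin (n + 1) → ℤ} {a : Fin (n + 1) →₀ ℕ} (h : ∀ k, u k ≤ a k) :
    posExponent u ≤ a := fun k => by
  have := h k
  change (u k).toNat ≤ a k
  omega

theorem posExponent_apply (u : Fin (n + 1) → ℤ) (k : Fin (n + 1)) :
    posExponent u k = (u k).toNat := rfl

variable {𝕜 : Type*} [Field 𝕜]

theorem chipBinomials_subset (M : Matrix (Fin (n + 1)) (Fin (n + 1)) ℤ) (S : Fin (n + 1) → ℕ) :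
    chipBinomials 𝕜 M S ⊆ latticeIdeal 𝕜 (rowLattice M) := by
  rintro _ ⟨x, -, rfl⟩
  refine Ideal.subset_span ⟨_, _, ?_, rfl⟩
  rw [mem_rowLattice_int_iff]
  refine ⟨fun i => (x i : ℤ), ?_⟩
  funext k
  simp only [posExponent_apply]
  change firing M x k = ((firing M x k).toNat : ℤ) - ((-firing M x k).toNat : ℤ)
  omega

theorem finite_chipBinomials (M : Matrix (Fin (n + 1)) (Fin (n + 1)) ℤ) (S : Fin (n + 1) → ℕ) :
    (chipBinomials 𝕜 M S).Finite := by
  refine ((Set.finite_Iic S).image fun x => (monomial (posExponent (firing M x)) 1 -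
    monomial (posExponent (-firing M x)) 1 : MvPolynomial (Fin (n + 1)) 𝕜)).subset ?_
  rintro _ ⟨x, hx, rfl⟩
  exact ⟨x, hx, rfl⟩

/-- Firing the top layer of `σ` is legal from `a` and changes `x^a` by a multiple of a chip
binomial; what remains of `σ` is nonnegative with a smaller sum. -/
theorem monomial_sub_mem_span_chipBinomials (hS : ∀ i, 0 < S i)
    (hMS : (laplacian (A.map ((↑) : ℕ → ℤ)))ᵀ *ᵥ (fun i => (S i : ℤ)) = 0)
    {σ : Fin (n + 1) → ℤ} (hσ : 0 ≤ σ) {a b : Fin (n + 1) →₀ ℕ}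
    (hab : (laplacian (A.map ((↑) : ℕ → ℤ)))ᵀ *ᵥ σ = fun k => (a k : ℤ) - (b k : ℤ)) :
    (monomial a 1 - monomial b 1 : MvPolynomial (Fin (n + 1)) 𝕜) ∈
      Ideal.span (chipBinomials 𝕜 (laplacian (A.map ((↑) : ℕ → ℤ))) S) := by
  set M := laplacian (A.map ((↑) : ℕ → ℤ)) with hM
  induction hN : (∑ k, σ k).toNat using Nat.strong_induction_on generalizing σ a with
  | _ N ih =>
  subst hN
  by_cases h0 : ∃ k, 0 < σ k
  · obtain ⟨x, hxS, ⟨k₀, hk₀⟩, hxσ, hleg⟩ := exists_legal_layer hS hMS h0 (a := a) fun k => by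
      rw [← hM, hab]
      simp
    rw [← hM] at hleg
    set u := firing M x with hu
    set c := a - posExponent u
    have hac : a = c + posExponent u := (tsub_add_cancel_of_le (posExponent_le hleg)).symm
    have hbin : (monomial a 1 - monomial (c + posExponent (-u)) 1 :
        MvPolynomial (Fin (n + 1)) 𝕜) ∈ Ideal.span (chipBinomials 𝕜 M S) := by
      have : (monomial a 1 - monomial (c + posExponent (-u)) 1 : MvPolynomial (Fin (n + 1)) 𝕜) =
          monomial c 1 * (monomial (posExponent u) 1 - monomial (posExponent (-u)) 1) := by
        rw [mul_sub, monomial_mul, monomial_mul, ← hac, one_mul]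
      rw [this]
      exact Ideal.mul_mem_left _ _ (Ideal.subset_span ⟨x, hxS, rfl⟩)
    have hxσ' : ∀ k, (x k : ℤ) ≤ σ k := fun k => by
      have := hxσ k
      rwa [max_eq_left (show 0 ≤ σ k from hσ k)] at this
    have hrest := ih (∑ k, (σ k - x k)).toNat (by
        have h1 : ∑ k, (σ k - x k) < ∑ k, σ k :=
          Finset.sum_lt_sum (fun k _ => by omega) ⟨k₀, Finset.mem_univ _, by omega⟩
        have h2 : 0 ≤ ∑ k, (σ k - x k) := Finset.sum_nonneg fun k _ => by linarith [hxσ' k]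
        omega)
      (σ := fun k => σ k - x k) (a := c + posExponent (-u))
      (fun k => by simpa using hxσ' k) (by
        have : (fun k => σ k - (x k : ℤ)) = σ - fun k => (x k : ℤ) := rfl
        rw [this, Matrix.mulVec_sub, hab]
        funext k
        change (a k : ℤ) - b k - u k = _
        have h1 : a k = c k + (u k).toNat := DFunLike.congr_fun hac k
        have h2 : (c + posExponent (-u)) k = c k + (-u k).toNat := rfl
        rw [h1, h2]
        push_cast
        omega) rfl
    have := add_mem hbin hrest
    rwa [sub_add_sub_cancel] at this
  · have : σ = 0 := by
      funext k
      push Not at h0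
      exact le_antisymm (h0 k) (hσ k)
    rw [this, Matrix.mulVec_zero] at hab
    have : a = b := Finsupp.ext fun k => by
      have := congrFun hab k
      simp only [Pi.zero_apply] at this
      omega
    rw [this, sub_self]
    exact zero_mem _

theorem span_chipBinomials (hS : ∀ i, 0 < S i)
    (hMS : (laplacian (A.map ((↑) : ℕ → ℤ)))ᵀ *ᵥ (fun i => (S i : ℤ)) = 0) :
    Ideal.span (chipBinomials 𝕜 (laplacian (A.map ((↑) : ℕ → ℤ))) S) =
      latticeIdeal 𝕜 (rowLattice (laplacian (A.map ((↑) : ℕ → ℤ)))) := by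
  refine le_antisymm (Ideal.span_le.2 (chipBinomials_subset _ _)) (Ideal.span_le.2 ?_)
  rintro _ ⟨a, b, hab, rfl⟩
  obtain ⟨σ, hσ⟩ := (mem_rowLattice_int_iff _ _).1 hab
  refine monomial_sub_mem_span_chipBinomials hS hMS
    -- Adding a multiple of the kernel vector `S` makes the firing nonnegative without changing its
    -- effect.
    (σ := σ + (∑ i, |σ i|) • fun i => (S i : ℤ)) (fun k => ?_) ?_
  · have h1 : |σ k| ≤ ∑ i, |σ i| :=
      Finset.single_le_sum (f := fun i => |σ i|) (fun _ _ => abs_nonneg _) (Finset.mem_univ k)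
    have h2 : (1 : ℤ) ≤ S k := by exact_mod_cast hS k
    have h3 := neg_abs_le (σ k)
    have h4 := abs_nonneg (σ k)
    simp only [Pi.zero_apply, Pi.add_apply, Pi.smul_apply, smul_eq_mul]
    nlinarith
  · rw [Matrix.mulVec_add, Matrix.mulVec_smul, hMS, smul_zero, add_zero, hσ]

theorem isGenericIdeal_of_hasFullSupport (hS : ∀ i, 0 < S i)
    (hMS : (laplacian (A.map ((↑) : ℕ → ℤ)))ᵀ *ᵥ (fun i => (S i : ℤ)) = 0)
    (hfull : HasFullSupport (laplacian (A.map ((↑) : ℕ → ℤ))) S) :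
    IsGenericIdeal (latticeIdeal 𝕜 (rowLattice (laplacian (A.map ((↑) : ℕ → ℤ))))) := by
  refine ⟨chipBinomials 𝕜 (laplacian (A.map ((↑) : ℕ → ℤ))) S \ {0}, ?_, ?_⟩
  · rintro _ ⟨⟨x, hx, rfl⟩, hne⟩
    refine ⟨_, _, fun k => ?_, rfl⟩
    have hfire : firing (laplacian (A.map ((↑) : ℕ → ℤ))) x ≠ 0 := by
      intro h
      refine hne ?_
      rw [h, neg_zero, sub_self]
      rfl
    have h0 : 0 < x := by
      refine lt_of_le_of_ne (fun _ => Nat.zero_le _) ?_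
      rintro rfl
      refine hfire ?_
      rw [firing]
      exact (congrArg _ (by funext; simp)).trans (Matrix.mulVec_zero _)
    have hS' : x < S := by
      refine lt_of_le_of_ne hx ?_
      rintro rfl
      exact hfire hMS
    have := hfull x h0 hS' k
    rw [posExponent_apply, posExponent_apply, Pi.neg_apply]
    omega
  · rw [Ideal.span_sdiff_singleton_zero, span_chipBinomials hS hMS]

end Firing

/-! ### The Gröbner basis -/

section Groebner

variable {A : Matrix (Fin (n + 1)) (Fin (n + 1)) ℕ} {S : Fin (n + 1) → ℕ}
  {T : Fin (n + 1) → Fin (n + 1) → Prop} {ρ : Equiv.Perm (Fin (n + 1))}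

/-- A loop would be the only tree edge out of `v`, so no path from `v` could reach the root. -/
theorem IsSpanningTree.not_self (hT : IsSpanningTree A T) (v : Fin (n + 1)) : ¬ T v v := by
  intro h
  by_cases hv : v = 0
  · subst hv
    exact hT.2.1 _ h
  obtain ⟨w, -, huniq⟩ := hT.2.2.1 v hv
  have hstay : ∀ z, Relation.ReflTransGen T v z → z = v := by
    intro z hz
    induction hz with
    | refl => rfl
    | tail _ hbc ih =>
      subst ih
      rw [huniq _ h]
      exact huniq _ hbc
  exact hv (hstay 0 (hT.2.2.2 v)).symm

/-- Firing a nonempty set of vertices other than the root moves money towards the root. -/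
theorem exists_first_neg (hT : IsSpanningTree A T) (hρ : IsLinearExtension T ρ)
    {y : Fin (n + 1) → ℤ} (hy : 0 ≤ y) (hy0 : y 0 = 0) (hne : ∃ k, 0 < y k) :
    ∃ w, ((laplacian (A.map ((↑) : ℕ → ℤ)))ᵀ *ᵥ y) w < 0 ∧
      ∀ k, ρ k < ρ w → ((laplacian (A.map ((↑) : ℕ → ℤ)))ᵀ *ᵥ y) k = 0 := by
  classical
  set u := (laplacian (A.map ((↑) : ℕ → ℤ)))ᵀ *ᵥ y with hu
  obtain ⟨k₀, hk₀⟩ := hne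
  -- Let `v` be the first vertex that fires. Earlier vertices only receive chips, and the tree
  -- successor of `v`, which is earlier, receives at least one; so the first nonzero coordinate is
  -- negative.
  obtain ⟨v, hv, hvmin⟩ := Finset.exists_min_image (Finset.univ.filter fun k => 0 < y k) ρ
    ⟨k₀, by simpa using hk₀⟩
  replace hv : 0 < y v := by simpa using hv
  have hsmall : ∀ k, ρ k < ρ v → y k = 0 := fun k hk => by
    by_contra h
    exact absurd (hvmin k (by simpa using lt_of_le_of_ne (hy k) (Ne.symm h))) (not_le.2 hk)
  have hle : ∀ k, ρ k < ρ v → u k ≤ 0 := fun k hk => by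
    have := fire_le_of_le (A := A) hy (k := k) (hsmall k hk).symm
    rwa [Matrix.mulVec_zero] at this
  have hv0 : v ≠ 0 := by
    rintro rfl
    omega
  obtain ⟨w, hvw, -⟩ := hT.2.2.1 v hv0
  have hw : ρ w < ρ v := by
    refine lt_of_le_of_ne (hρ w v (Relation.ReflTransGen.single hvw)) fun h => ?_
    rw [ρ.injective h] at hvw
    exact hT.not_self v hvw
  have huw : u w < 0 := by
    rw [hu, transpose_laplacian_mulVec, hsmall w hw, zero_mul, zero_sub, neg_lt_zero]
    refine Finset.sum_pos' (fun s _ => mul_nonneg (hy s) (Int.natCast_nonneg _))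
      ⟨v, Finset.mem_univ _, mul_pos hv ?_⟩
    exact Int.natCast_pos.2 (hT.1 v w hvw)
  obtain ⟨w', hw', hmin⟩ := Finset.exists_min_image (Finset.univ.filter fun k => u k ≠ 0) ρ
    ⟨w, by simpa using huw.ne⟩
  replace hw' : u w' ≠ 0 := by simpa using hw'
  have hww : ρ w' ≤ ρ w := hmin w (by simpa using huw.ne)
  refine ⟨w', lt_of_le_of_ne (hle w' (hww.trans_lt hw)) hw', fun k hk => ?_⟩
  by_contra h
  exact absurd (hmin k (by simpa using h)) (not_le.2 hk)

/-- A monomial that is not minimal in its class is divisible by a leading monomial. -/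
theorem exists_legal_descending (hS : ∀ i, 0 < S i) (hS0 : S 0 = 1)
    (hMS : (laplacian (A.map ((↑) : ℕ → ℤ)))ᵀ *ᵥ (fun i => (S i : ℤ)) = 0)
    (hT : IsSpanningTree A T) (hρ : IsLinearExtension T ρ) {a b : Fin (n + 1) →₀ ℕ}
    (hab : (fun k => (a k : ℤ) - (b k : ℤ)) ∈ rowLattice (laplacian (A.map ((↑) : ℕ → ℤ))))
    (hlt : (show Grevlex ρ from b) < (show Grevlex ρ from a)) :
    ∃ x : Fin (n + 1) → ℕ, x ≤ S ∧
      (∀ k, firing (laplacian (A.map ((↑) : ℕ → ℤ))) x k ≤ a k) ∧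
      (show Grevlex ρ from posExponent (-firing (laplacian (A.map ((↑) : ℕ → ℤ))) x)) <
        (show Grevlex ρ from posExponent (firing (laplacian (A.map ((↑) : ℕ → ℤ))) x)) := by
  obtain ⟨τ, hτ⟩ := (mem_rowLattice_int_iff _ _).1 hab
  obtain ⟨σ, hσ0, hσ⟩ : ∃ σ : Fin (n + 1) → ℤ, σ 0 = 0 ∧
      (laplacian (A.map ((↑) : ℕ → ℤ)))ᵀ *ᵥ σ = fun k => (a k : ℤ) - (b k : ℤ) := by
    -- Because `S 0 = 1`, the root coordinate can be normalised to zero exactly.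
    refine ⟨τ - τ 0 • fun i => (S i : ℤ), by simp [hS0], ?_⟩
    rw [Matrix.mulVec_sub, Matrix.mulVec_smul, hMS, smul_zero, sub_zero, hτ]
  have hsum : ∑ k, b k = ∑ k, a k := by
    have := sum_fire (A := A) σ
    rw [hσ, Finset.sum_sub_distrib, sub_eq_zero] at this
    exact_mod_cast this.symm
  -- Otherwise `-σ` is a nonnegative firing that avoids the root and leads from `b` to `a`. It would
  -- move chips towards the root and make `a` smaller than `b`.
  have hpos : ∃ k, 0 < σ k := by
    by_contra! hle
    have hneg : ∃ k, 0 < (-σ) k := by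
      by_contra! h
      have : σ = 0 := by
        funext k
        have h1 := hle k
        have h2 := h k
        simp only [Pi.neg_apply, Pi.zero_apply] at h2 ⊢
        omega
      rw [this, Matrix.mulVec_zero] at hσ
      have : b = a := Finsupp.ext fun k => by
        have := congrFun hσ k
        simp only [Pi.zero_apply] at this
        omega
      exact lt_irrefl _ (this ▸ hlt)
    obtain ⟨w, hw, hw'⟩ := exists_first_neg hT hρ (y := -σ)
      (fun k => by simpa using hle k) (by simp [hσ0]) hneg
    rw [Matrix.mulVec_neg, hσ] at hw hw'
    simp only [Pi.neg_apply] at hw hw'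
    refine lt_asymm hlt ((grevlex_lt_iff ρ a b).2 (Or.inr ⟨hsum.symm, w, by omega, fun k hk => ?_⟩))
    have := hw' k hk
    omega
  obtain ⟨x, hxS, hx, hxσ, hleg⟩ := exists_legal_layer hS hMS hpos (a := a) fun k => by
    rw [hσ]
    simp
  refine ⟨x, hxS, hleg, ?_⟩
  -- The layer inherits `x 0 = 0` from `σ 0 = 0`, so its own firing is descending too.
  obtain ⟨w, hw, hw'⟩ := exists_first_neg hT hρ (y := fun i => (x i : ℤ))
    (fun k => Int.natCast_nonneg _) (by
      have := hxσ 0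
      rw [hσ0, max_self] at this
      exact le_antisymm this (Int.natCast_nonneg _)) (by simpa using hx)
  change firing (laplacian (A.map ((↑) : ℕ → ℤ))) x w < 0 at hw
  change ∀ k, ρ k < ρ w → firing (laplacian (A.map ((↑) : ℕ → ℤ))) x k = 0 at hw'
  have hsum' : ∑ k, firing (laplacian (A.map ((↑) : ℕ → ℤ))) x k = 0 := sum_fire _
  set u := firing (laplacian (A.map ((↑) : ℕ → ℤ))) x
  refine (grevlex_lt_iff ρ _ _).2 (Or.inr ⟨?_, w, ?_, fun k hk => ?_⟩)
  · simp only [posExponent_apply, Pi.neg_apply]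
    have h1 : ∑ k, (((u k).toNat : ℤ) - ((-u k).toNat : ℤ)) = 0 := by
      rw [← hsum']
      exact Finset.sum_congr rfl fun k _ => by omega
    rw [Finset.sum_sub_distrib, sub_eq_zero] at h1
    exact_mod_cast h1.symm
  · rw [posExponent_apply, posExponent_apply, Pi.neg_apply]
    omega
  · rw [posExponent_apply, posExponent_apply, Pi.neg_apply, hw' k hk]
    rfl

variable {𝕜 : Type*} [Field 𝕜]

theorem leadingTerm_monomial_sub {m : MonomialOrder (Fin (n + 1))} {a b : Fin (n + 1) →₀ ℕ}
    (h : m.toSyn b < m.toSyn a) :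
    m.leadingTerm (monomial a 1 - monomial b 1 : MvPolynomial (Fin (n + 1)) 𝕜) = monomial a 1 := by
  classical
  have hdeg : ∀ c : Fin (n + 1) →₀ ℕ, m.degree (monomial c 1 : MvPolynomial (Fin (n + 1)) 𝕜) = c :=
    fun c => by rw [m.degree_monomial, if_neg one_ne_zero]
  have h' : m.toSyn (m.degree (monomial b 1 : MvPolynomial (Fin (n + 1)) 𝕜)) <
      m.toSyn (m.degree (monomial a 1 : MvPolynomial (Fin (n + 1)) 𝕜)) := by rwa [hdeg, hdeg]
  rw [MonomialOrder.leadingTerm, MonomialOrder.degree_sub_of_lt h',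
    MonomialOrder.leadingCoeff_sub_of_lt h', hdeg, MonomialOrder.leadingCoeff_monomial]

/-- The leading monomial of a nonzero `f` in the ideal is congruent to another, hence smaller,
monomial of `f`; so a legal descending firing starts from it, and the leading monomial of that
binomial divides it. -/
theorem isGroebnerBasis_chipBinomials (hS : ∀ i, 0 < S i) (hS0 : S 0 = 1)
    (hMS : (laplacian (A.map ((↑) : ℕ → ℤ)))ᵀ *ᵥ (fun i => (S i : ℤ)) = 0)
    (hT : IsSpanningTree A T) (hρ : IsLinearExtension T ρ) :
    IsGroebnerBasis (grevlex ρ) (latticeIdeal 𝕜 (rowLattice (laplacian (A.map ((↑) : ℕ → ℤ)))))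
      (chipBinomials 𝕜 (laplacian (A.map ((↑) : ℕ → ℤ))) S) := by
  refine ⟨finite_chipBinomials _ _, chipBinomials_subset _ _, le_antisymm
    (Ideal.span_mono (Set.image_mono (chipBinomials_subset _ _))) (Ideal.span_le.2 ?_)⟩
  rintro _ ⟨f, hf, rfl⟩
  by_cases hf0 : f = 0
  · rw [hf0, MonomialOrder.leadingTerm, MonomialOrder.leadingCoeff_zero, monomial_zero]
    exact zero_mem _
  obtain ⟨b, hb, hba, hab⟩ := exists_ne_mem_support hf ((grevlex ρ).degree_mem_support hf0)
  have hlt : (show Grevlex ρ from b) < (show Grevlex ρ from (grevlex ρ).degree f) :=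
    lt_of_le_of_ne ((grevlex ρ).le_degree hb) hba
  obtain ⟨x, hxS, hleg, hlead⟩ := exists_legal_descending hS hS0 hMS hT hρ hab hlt
  have hmem : (monomial (posExponent (firing (laplacian (A.map ((↑) : ℕ → ℤ))) x)) 1 :
      MvPolynomial (Fin (n + 1)) 𝕜) ∈ Ideal.span ((grevlex ρ).leadingTerm ''
        chipBinomials 𝕜 (laplacian (A.map ((↑) : ℕ → ℤ))) S) :=
    Ideal.subset_span ⟨_, ⟨x, hxS, rfl⟩, leadingTerm_monomial_sub hlead⟩
  have := Ideal.mul_mem_left _ (monomial ((grevlex ρ).degree f -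
    posExponent (firing (laplacian (A.map ((↑) : ℕ → ℤ))) x)) ((grevlex ρ).leadingCoeff f)) hmem
  rw [monomial_mul, mul_one, tsub_add_cancel_of_le (posExponent_le hleg)] at this
  exact this

end Groebner

/-! ### Tail-sum coordinates on the root lattice -/

/-- The vector with prescribed tail sums. -/
def ofTailSums (n : ℕ) : (ℕ → ℤ) →+ (Fin (n + 1) → ℤ) where
  toFun d j := d j - d (j + 1)
  map_zero' := by
    funext j
    simp
  map_add' a b := by
    funext j
    simp only [Pi.add_apply]
    ring

theorem ofTailSums_apply (d : ℕ → ℤ) (j : Fin (n + 1)) :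
    ofTailSums n d j = d j - d (j + 1) := rfl

theorem sum_ofTailSums (d : ℕ → ℤ) : ∑ j, ofTailSums n d j = d 0 - d (n + 1) := by
  simp only [ofTailSums_apply]
  rw [Fin.sum_univ_eq_sum_range (fun j => d j - d (j + 1)), Finset.sum_range_sub']

/-- The support of `d` lies in `[1, n]`, the coordinates of the root lattice. -/
def IsTail (n : ℕ) (d : ℕ → ℤ) : Prop := d 0 = 0 ∧ ∀ j, n < j → d j = 0

theorem exists_isTail {v : Fin (n + 1) → ℤ} (hv : v ∈ rootLattice n) :
    ∃ d, IsTail n d ∧ ofTailSums n d = v := by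
  have hv' : ∑ k, v k = 0 := hv
  refine ⟨fun k => ∑ j : Fin (n + 1), if k ≤ j then v j else 0, ⟨by simpa using hv', fun k hk => ?_⟩, ?_⟩
  · exact Finset.sum_eq_zero fun j _ => if_neg (by have := j.isLt; omega)
  · funext i
    rw [ofTailSums_apply, ← Finset.sum_sub_distrib, Finset.sum_eq_single i]
    · simp
    · intro j _ hj
      have : (j : ℕ) ≠ i := fun h => hj (Fin.ext h)
      by_cases h : (i : ℕ) ≤ j
      · rw [if_pos h, if_pos (by omega), sub_self]
      · rw [if_neg h, if_neg (by omega), sub_self]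
    · simp

theorem ofTailSums_mem_rootLattice {d : ℕ → ℤ} (hd : IsTail n d) :
    ofTailSums n d ∈ rootLattice n := by
  change ∑ j, ofTailSums n d j = 0
  rw [sum_ofTailSums, hd.1, hd.2 _ (Nat.lt_succ_self n), sub_self]

/-- The factorial of the index is divisible by every positive integer up to the index, so it carries
the whole root lattice into `L`. -/
theorem exists_pos_mul_mem {L : AddSubgroup (Fin (n + 1) → ℤ)}
    (hfin : L.relIndex (rootLattice n) ≠ 0) :
    ∃ N : ℤ, 0 < N ∧ ∀ d, IsTail n d → (∀ j, N ∣ d j) → ofTailSums n d ∈ L := by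
  refine ⟨(Nat.factorial (L.relIndex (rootLattice n)) : ℕ),
    by exact_mod_cast Nat.factorial_pos _, fun d hd hdvd => ?_⟩
  choose c hc using hdvd
  have hN : ((Nat.factorial (L.relIndex (rootLattice n)) : ℕ) : ℤ) ≠ 0 := by
    exact_mod_cast Nat.factorial_ne_zero _
  have hcT : IsTail n c := by
    constructor
    · have := hc 0
      rw [hd.1] at this
      exact (mul_eq_zero.1 this.symm).resolve_left hN
    · intro j hj
      have := hc j
      rw [hd.2 j hj] at this
      exact (mul_eq_zero.1 this.symm).resolve_left hN
  have h1 : d = Nat.factorial (L.relIndex (rootLattice n)) • c := by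
    funext j
    simp [hc j]
  rw [h1, map_nsmul]
  exact (AddSubgroup.nsmul_mem_of_relIndex_ne_zero_of_dvd hfin (ofTailSums_mem_rootLattice hcT)
    fun m h0 hm => Nat.dvd_factorial h0 hm).1

/-- The vectors of a triangular basis of `L`, with tail sums that increase to zero after the leading
one. -/
theorem exists_triangular_vector {L : AddSubgroup (Fin (n + 1) → ℤ)} {N : ℤ} (hN : 0 < N)
    (hNL : ∀ d, IsTail n d → (∀ j, N ∣ d j) → ofTailSums n d ∈ L) {k : ℕ} (hk : 1 ≤ k)
    (hkn : k ≤ n) :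
    ∃ d, IsTail n d ∧ ofTailSums n d ∈ L ∧ (∀ j < k, d j = 0) ∧ 0 < d k ∧ d k ≤ N ∧
      (∀ j, k < j → d j ≤ d (j + 1)) ∧
      ∀ d', IsTail n d' → ofTailSums n d' ∈ L → (∀ j < k, d' j = 0) → d k ∣ d' k := by
  -- `H` collects the possible leading tail sums at position `k`; its positive generator is the
  -- diagonal entry of the triangular basis.
  let H : AddSubgroup ℤ :=
    { carrier := {z | ∃ d, IsTail n d ∧ ofTailSums n d ∈ L ∧ (∀ j < k, d j = 0) ∧ d k = z}
      zero_mem' := ⟨0, ⟨rfl, fun _ _ => rfl⟩, by rw [map_zero]; exact L.zero_mem,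
        fun _ _ => rfl, rfl⟩
      add_mem' := by
        rintro _ _ ⟨a, ha, haL, ha', rfl⟩ ⟨b, hb, hbL, hb', rfl⟩
        refine ⟨a + b, ⟨by simp [ha.1, hb.1], fun j hj => by simp [ha.2 j hj, hb.2 j hj]⟩, ?_,
          fun j hj => by simp [ha' j hj, hb' j hj], rfl⟩
        rw [map_add]
        exact L.add_mem haL hbL
      neg_mem' := by
        rintro _ ⟨a, ha, haL, ha', rfl⟩
        refine ⟨-a, ⟨by simp [ha.1], fun j hj => by simp [ha.2 j hj]⟩, ?_,
          fun j hj => by simp [ha' j hj], rfl⟩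
        rw [map_neg]
        exact L.neg_mem haL }
  have hNH : N ∈ H := by
    refine ⟨Pi.single k N, ⟨?_, fun j hj => ?_⟩, hNL _ ⟨?_, fun j hj => ?_⟩ fun j => ?_,
      fun j hj => ?_, ?_⟩
    · exact Pi.single_eq_of_ne (by omega) _
    · exact Pi.single_eq_of_ne (by omega) _
    · exact Pi.single_eq_of_ne (by omega) _
    · exact Pi.single_eq_of_ne (by omega) _
    · by_cases hj : j = k
      · subst hj
        simp
      · simp [hj]
    · exact Pi.single_eq_of_ne (by omega) _
    · simp
  obtain ⟨u, hu0, huH, hudvd⟩ : ∃ u, 0 < u ∧ u ∈ H ∧ ∀ z ∈ H, u ∣ z := by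
    obtain ⟨g, hg⟩ := Int.subgroup_cyclic H
    rw [← AddSubgroup.zmultiples_eq_closure] at hg
    have hgH : g ∈ H := hg ▸ AddSubgroup.mem_zmultiples g
    have hdvd : ∀ z ∈ H, g ∣ z := fun z hz => by
      rw [hg, Int.mem_zmultiples_iff] at hz
      exact hz
    have hg0 : g ≠ 0 := by
      rintro rfl
      have := zero_dvd_iff.1 (hdvd N hNH)
      omega
    refine ⟨|g|, abs_pos.2 hg0, ?_, fun z hz => (abs_dvd _ _).2 (hdvd z hz)⟩
    rcases abs_choice g with h | h
    · rwa [h]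
    · rw [h]
      exact H.neg_mem hgH
  obtain ⟨d, hd, hdL, hdk, hdu⟩ := huH
  -- Later tail sums may be altered by multiples of `N`. This places the one at `j` in the interval
  -- `[-N(n+1-j), -N(n-j))`; consecutive intervals increase and the last one ends at `0`.
  set d' : ℕ → ℤ := fun j => if j ≤ k then d j else if j ≤ n then
    d j % N - N * (n + 1 - j) else 0 with hd'
  have hd'T : IsTail n d' := by
    constructor
    · simp [hd', hd.1]
    · intro j hj
      simp only [hd']
      rw [if_neg (by omega), if_neg (by omega)]
  have hd'k : d' k = u := by simp [hd', hdu]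
  refine ⟨d', hd'T, ?_, fun j hj => ?_, ?_, ?_, fun j hj => ?_, fun e he heL hek => ?_⟩
  · have h1 : d' = d - (d - d') := by simp
    rw [h1, map_sub]
    refine L.sub_mem hdL (hNL _ ⟨by simp [hd.1, hd'T.1], fun j hj => by
      simp [hd.2 j hj, hd'T.2 j hj]⟩ fun j => ?_)
    simp only [Pi.sub_apply]
    by_cases h1 : j ≤ k
    · simp [hd', h1]
    · by_cases h2 : j ≤ n
      · refine ⟨d j / N + (n + 1 - j), ?_⟩
        simp only [hd', if_neg h1, if_pos h2]
        have := Int.emod_add_mul_ediv (d j) N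
        linarith
      · simp [hd.2 j (by omega), hd'T.2 j (by omega)]
  · simp [hd', hj.le, hdk j hj]
  · rwa [hd'k]
  · rw [hd'k]
    exact Int.le_of_dvd hN (hudvd N hNH)
  · rcases lt_or_ge n j with hnj | hnj
    · rw [hd'T.2 j hnj, hd'T.2 (j + 1) (by omega)]
    · have h1 : d' j = d j % N - N * (n + 1 - j) := by
        simp only [hd']
        rw [if_neg (by omega), if_pos hnj]
      have h2 := Int.emod_lt_of_pos (d j) hN
      have hj' : (j : ℤ) ≤ n := by exact_mod_cast hnj
      rcases lt_or_ge n (j + 1) with hnj' | hnj'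
      · rw [hd'T.2 (j + 1) hnj', h1]
        nlinarith
      · have h3 : d' (j + 1) = d (j + 1) % N - N * (n + 1 - (j + 1 : ℕ)) := by
          simp only [hd']
          rw [if_neg (by omega), if_pos hnj']
        have h4 := Int.emod_nonneg (d (j + 1)) hN.ne'
        rw [h1, h3]
        push_cast
        nlinarith
  · rw [hd'k]
    exact hudvd _ ⟨e, he, heL, hek, rfl⟩

/-- Positive coefficients for which a triangular system has decreasing positive column sums. -/
theorem exists_decreasing_combination {d : ℕ → ℕ → ℤ} {N : ℤ} (n : ℕ)
    (hpos : ∀ k, 1 ≤ k → k ≤ n → 0 < d k k) (hN : ∀ k, 1 ≤ k → k ≤ n → d k k ≤ N)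
    (hneg : ∀ i k, 1 ≤ i → i < k → k ≤ n → d i k ≤ 0) (hN0 : 0 < N) {m : ℕ} (hm : m ≤ n) :
    ∃ (S : ℕ → ℕ) (q : ℤ), (∀ k, 1 ≤ k → k ≤ m → 0 < S k) ∧
      (∀ k, 1 ≤ k → k < m →
        ∑ i ∈ Finset.Icc 1 (k + 1), S i * d i (k + 1) ≤ ∑ i ∈ Finset.Icc 1 k, S i * d i k) ∧
      (1 ≤ m → ∑ i ∈ Finset.Icc 1 m, S i * d i m = q) ∧ 1 + N * (n - m) ≤ q := by
  induction m with
  -- The starting value `1 + N n` leaves room for `n` drops of at most `N` while the final sum stays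
  -- positive.
  | zero => exact ⟨0, 1 + N * n, by omega, by omega, by omega, by simp⟩
  | succ m ih =>
    obtain ⟨S, q, h1, h2, h3, h4⟩ := ih (by omega)
    set c := ∑ i ∈ Finset.Icc 1 m, S i * d i (m + 1) with hc
    have hc0 : c ≤ 0 := Finset.sum_nonpos fun i hi => by
      rw [Finset.mem_Icc] at hi
      exact mul_nonpos_of_nonneg_of_nonpos (Int.natCast_nonneg _)
        (hneg i (m + 1) hi.1 (by omega) hm)
    set u := d (m + 1) (m + 1) with hu
    have hu0 : 0 < u := hpos _ (by omega) hm
    have huN : u ≤ N := hN _ (by omega) hm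
    -- The largest coefficient that keeps the new column sum at most `q`; rounding down loses less
    -- than `u ≤ N`.
    set s := (q - c) / u with hs
    have hmn : (m : ℤ) + 1 ≤ n := by exact_mod_cast hm
    have hqN : 1 + N ≤ q := by nlinarith
    have hs1 : 0 < s := lt_of_lt_of_le one_pos ((Int.le_ediv_iff_mul_le hu0).2 (by linarith))
    have hs2 : s * u ≤ q - c := Int.ediv_mul_le _ hu0.ne'
    have hs3 : q - c < s * u + u := by
      have := Int.lt_ediv_add_one_mul_self (q - c) hu0
      linarith
    have hS : ∀ k i, k ≤ m → i ∈ Finset.Icc 1 k →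
        Function.update S (m + 1) s.toNat i = S i := fun k i hk hi => by
      rw [Finset.mem_Icc] at hi
      exact Function.update_of_ne (by omega) _ _
    have hsum : ∀ k j, k ≤ m → ∑ i ∈ Finset.Icc 1 k,
        (Function.update S (m + 1) s.toNat i : ℤ) * d i j = ∑ i ∈ Finset.Icc 1 k, S i * d i j :=
      fun k j hk => Finset.sum_congr rfl fun i hi => by rw [hS k i hk hi]
    have hlast : ∑ i ∈ Finset.Icc 1 (m + 1),
        (Function.update S (m + 1) s.toNat i : ℤ) * d i (m + 1) = c + s * u := by
      rw [Finset.sum_Icc_succ_top (by omega), hsum m _ le_rfl, Function.update_self,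
        Int.toNat_of_nonneg hs1.le]
    refine ⟨Function.update S (m + 1) s.toNat, c + s * u, fun k hk hkm => ?_, fun k hk hkm => ?_,
      fun _ => hlast, ?_⟩
    · by_cases hkm' : k = m + 1
      · rw [hkm', Function.update_self]
        omega
      · rw [Function.update_of_ne hkm']
        exact h1 k hk (by omega)
    · rw [hsum k k (by omega)]
      by_cases hkm' : k = m
      · subst hkm'
        rw [hlast, h3 hk]
        linarith
      · rw [hsum (k + 1) (k + 1) (by omega)]
        exact h2 k hk (by omega)
    · push_cast
      nlinarith

/-- The entries of a row are the drops of its tail sums, so off-diagonal entries are nonpositive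
exactly when the tail sums do not drop outside the diagonal position. The triangular vectors satisfy
this for rows `1, …, n`. Row `0` is minus their combination with coefficients `S`, and the
decreasing column sums make it satisfy the condition as well. -/
theorem exists_isPreprocessed (hn : 1 ≤ n) {L : AddSubgroup (Fin (n + 1) → ℤ)}
    (hL : L ≤ rootLattice n) (hfin : L.relIndex (rootLattice n) ≠ 0) :
    ∃ A S, IsPreprocessed L A S := by
  obtain ⟨N, hN, hNL⟩ := exists_pos_mul_mem hfin
  have hd := fun (k : ℕ) (hk : 1 ≤ k ∧ k ≤ n) => exists_triangular_vector hN hNL hk.1 hk.2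
  choose! d hdT hdL hdlow hdpos hdN hdmono hddvd using hd
  have hdnp : ∀ i k, 1 ≤ i → i < k → k ≤ n → d i k ≤ 0 := by
    intro i k hi hik hk
    have h1 : ∀ j, i < j → j ≤ n + 1 → d i j ≤ d i (n + 1) := by
      intro j hij hj
      induction hj using Nat.decreasingInduction with
      | self => exact le_rfl
      | of_succ j hj ih => exact (hdmono i ⟨hi, by omega⟩ j hij).trans (ih (by omega))
    exact (h1 k hik (by omega)).trans ((hdT i ⟨hi, by omega⟩).2 _ (Nat.lt_succ_self n)).le
  obtain ⟨S, q, hSpos, hSdec, hSq, hq⟩ := exists_decreasing_combination (d := d) (N := N) n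
    (fun k h1 h2 => hdpos k ⟨h1, h2⟩) (fun k h1 h2 => hdN k ⟨h1, h2⟩) hdnp hN le_rfl
  replace hSq := hSq hn
  rw [sub_self, mul_zero, add_zero] at hq
  set t : ℕ → ℤ := fun k => ∑ i ∈ Finset.Icc 1 n, S i * d i k with ht
  have htk : ∀ k, k ≤ n → t k = ∑ i ∈ Finset.Icc 1 k, S i * d i k := fun k hk => by
    refine (Finset.sum_subset (Finset.Icc_subset_Icc_right hk) fun i hi hi' => ?_).symm
    rw [Finset.mem_Icc] at hi hi'
    rw [hdlow i hi k (by omega), mul_zero]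
  have htT : IsTail n t :=
    ⟨Finset.sum_eq_zero fun i hi => by
      rw [(hdT i (Finset.mem_Icc.1 hi)).1, mul_zero], fun j hj => Finset.sum_eq_zero fun i hi => by
      rw [(hdT i (Finset.mem_Icc.1 hi)).2 j hj, mul_zero]⟩
  have htdec : ∀ k, 1 ≤ k → k < n → t (k + 1) ≤ t k := fun k h1 h2 => by
    rw [htk k h2.le, htk (k + 1) h2]
    exact hSdec k h1 h2
  have htn : 1 ≤ t n := by
    rw [htk n le_rfl, hSq]
    exact hq
  -- the Laplacian
  set r : ℕ → ℕ → ℤ := fun i => if i = 0 then -t else d i with hr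
  have hr0 : r 0 = -t := rfl
  have hrk : ∀ i, 1 ≤ i → r i = d i := fun i hi => if_neg (by omega)
  have hrT : ∀ i : Fin (n + 1), IsTail n (r i) := by
    intro i
    by_cases hi : (i : ℕ) = 0
    · rw [hi, hr0]
      exact ⟨by simp [htT.1], fun j hj => by simp [htT.2 j hj]⟩
    · rw [hrk i (by omega)]
      exact hdT i ⟨by omega, by omega⟩
  set M : Matrix (Fin (n + 1)) (Fin (n + 1)) ℤ := Matrix.of fun i => ofTailSums n (r i) with hM
  have hMa : ∀ i j, M i j = r i j - r i (j + 1) := fun i j => rfl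
  have hoff : ∀ i j, i ≠ j → M i j ≤ 0 := by
    intro i j hij
    rw [hMa]
    have hij' : (i : ℕ) ≠ j := fun h => hij (Fin.ext h)
    have hjn := j.isLt
    have hin := i.isLt
    by_cases hi : (i : ℕ) = 0
    · rw [hi, hr0]
      simp only [Pi.neg_apply]
      rcases lt_or_ge (j : ℕ) n with hj | hj
      · have := htdec j (by omega) hj
        linarith
      · have hjn' : (j : ℕ) = n := by omega
        have := htT.2 (n + 1) (Nat.lt_succ_self n)
        rw [hjn', this]
        linarith
    · rw [hrk i (by omega)]
      have hiI : 1 ≤ (i : ℕ) ∧ (i : ℕ) ≤ n := by omega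
      rcases lt_or_gt_of_ne hij' with h | h
      · have := hdmono i hiI j h
        linarith
      · rw [hdlow i hiI j h, zero_sub, neg_nonpos]
        rcases lt_or_ge ((j : ℕ) + 1) i with h' | h'
        · exact (hdlow i hiI _ h').ge
        · have : (j : ℕ) + 1 = i := by omega
          rw [this]
          exact (hdpos i hiI).le
  set A : Matrix (Fin (n + 1)) (Fin (n + 1)) ℕ := Matrix.of fun i j => (-M i j).toNat with hA
  have hMA : M = laplacian (A.map ((↑) : ℕ → ℤ)) := by
    refine eq_laplacian_of_row_sum (fun i => ?_) fun i j hij => ?_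
    · exact ofTailSums_mem_rootLattice (hrT i)
    · have := hoff i j hij
      simp only [hA, Matrix.map_apply, Matrix.of_apply]
      omega
  have hApos : ∀ i j, M i j < 0 → 0 < A i j := fun i j h => by
    simp only [hA, Matrix.of_apply]
    omega
  -- The positive diagonal tail sums give edges from `i` to `i - 1`, and `t n ≥ 1` gives an edge
  -- from `0` to `n`; together they form a directed cycle through all vertices.
  have hstep : ∀ i j : Fin (n + 1), (j : ℕ) + 1 = i → 0 < A i j := fun i j hij => by
    have hiI : 1 ≤ (i : ℕ) ∧ (i : ℕ) ≤ n := ⟨by omega, by omega⟩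
    refine hApos _ _ ?_
    rw [hMa, hrk i hiI.1, hdlow i hiI j (by omega), hij, zero_sub, neg_lt_zero]
    exact hdpos i hiI
  have hback : 0 < A 0 (Fin.last n) := by
    refine hApos _ _ ?_
    rw [hMa]
    change r 0 n - r 0 (n + 1) < 0
    rw [hr0]
    simp only [Pi.neg_apply]
    rw [htT.2 (n + 1) (Nat.lt_succ_self n)]
    linarith
  have hdesc : ∀ (k : ℕ) (i j : Fin (n + 1)), (i : ℕ) = j + k →
      Relation.ReflTransGen (fun a b => 0 < A a b) i j := by
    intro k
    induction k with
    | zero =>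
      intro i j hij
      rw [Fin.ext (show (i : ℕ) = j by omega)]
    | succ k ih =>
      intro i j hij
      have hi := i.isLt
      exact (ih i ⟨j + 1, by omega⟩ (by simp only; omega)).tail (hstep _ _ rfl)
  have hconn : StronglyConnected A := fun u v =>
    ((hdesc u u 0 (by simp)).tail hback).trans (hdesc (n - v) (Fin.last n) v (by
      have := v.isLt
      rw [Fin.val_last]
      omega))
  -- the left kernel
  set S' : Fin (n + 1) → ℕ := fun i => if (i : ℕ) = 0 then 1 else S i with hS'
  have hS'pos : ∀ i, 0 < S' i := fun i => by
    simp only [hS']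
    split_ifs with h
    · exact one_pos
    · exact hSpos i (by omega) (by omega)
  have hker : ∀ j, ∑ i, (S' i : ℤ) * M i j = 0 := by
    have h1 : ∀ k, ∑ i, (S' i : ℤ) * r i k = 0 := fun k => by
      rw [Fin.sum_univ_eq_sum_range (fun i => (((if i = 0 then 1 else S i) : ℕ) : ℤ) * r i k) (n + 1),
        Finset.sum_range_succ', if_pos rfl, hr0]
      have hIcc : Finset.Icc 1 n = Finset.Ico 1 (n + 1) := by
        ext i
        simp only [Finset.mem_Icc, Finset.mem_Ico]
        omega
      have h2 : t k = ∑ i ∈ Finset.range n, (S (i + 1) : ℤ) * d (i + 1) k := by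
        simp only [ht]
        rw [hIcc, Finset.sum_Ico_eq_sum_range]
        simp only [add_comm 1, Nat.add_sub_cancel]
      rw [Pi.neg_apply, h2, Nat.cast_one, one_mul, ← sub_eq_add_neg, sub_eq_zero]
      refine Finset.sum_congr rfl fun i _ => ?_
      rw [hrk (i + 1) (by omega), if_neg (by omega)]
    intro j
    simp only [hMa, mul_sub, Finset.sum_sub_distrib, h1, sub_self]
  refine ⟨A, S', hconn, ?_, hS'pos, rfl, ?_⟩
  · rw [← hMA]
    apply le_antisymm
    · rw [rowLattice, AddSubgroup.closure_le]
      have hrow : ∀ i, 1 ≤ i ∧ i ≤ n → ofTailSums n (d i) ∈ L := hdL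
      rintro _ ⟨i, rfl⟩
      by_cases hi : (i : ℕ) = 0
      · have h1 : M i = -∑ k ∈ Finset.Icc 1 n, S k • ofTailSums n (d k) := by
          change ofTailSums n (r i) = _
          rw [hi, hr0, map_neg]
          congr 1
          simp only [← map_nsmul, ← map_sum]
          congr 1
          funext k
          simp [ht]
        change M i ∈ L
        rw [h1]
        exact L.neg_mem (L.sum_mem fun k hk => L.nsmul_mem (hrow k (Finset.mem_Icc.1 hk)) _)
      · change ofTailSums n (r i) ∈ L
        rw [hrk i (by omega)]
        exact hrow i ⟨by omega, by omega⟩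
    · have key : ∀ k, 1 ≤ k → k ≤ n + 1 → ∀ e, IsTail n e → ofTailSums n e ∈ L →
          (∀ j < k, e j = 0) → ofTailSums n e ∈ rowLattice M := by
        intro k hk1 hk
        induction hk using Nat.decreasingInduction with
        | self =>
          intro e he _ hlow
          have : e = 0 := funext fun j => by
            rcases lt_or_ge n j with h | h
            · exact he.2 j h
            · exact hlow j (by omega)
          rw [this, map_zero]
          exact zero_mem _
        | of_succ k hk ih =>
          intro e he heL hlow
          have hkI : 1 ≤ k ∧ k ≤ n := by omega
          obtain ⟨c, hc⟩ := hddvd k hkI e he heL hlow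
          have h1 : ofTailSums n e = ofTailSums n (e - c • d k) + c • ofTailSums n (d k) := by
            rw [map_sub, map_zsmul, sub_add_cancel]
          rw [h1]
          have hmemrow : ofTailSums n (d k) ∈ rowLattice M := by
            refine AddSubgroup.subset_closure ⟨⟨k, by omega⟩, ?_⟩
            change ofTailSums n (r k) = _
            rw [hrk k hk1]
          refine add_mem (ih (by omega) _ ⟨?_, fun j hj => ?_⟩ ?_ fun j hj => ?_)
            (zsmul_mem hmemrow _)
          · simp [he.1, (hdT k hkI).1]
          · simp [he.2 j hj, (hdT k hkI).2 j hj]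
          · rw [map_sub, map_zsmul]
            exact L.sub_mem heL (L.zsmul_mem (hdL k hkI) _)
          · simp only [Pi.sub_apply, Pi.smul_apply, smul_eq_mul]
            rcases Nat.lt_succ_iff_lt_or_eq.1 hj with h | rfl
            · rw [hlow j h, hdlow k hkI j h, mul_zero, sub_zero]
            · rw [hc]
              ring
      intro v hv
      obtain ⟨e, he, rfl⟩ := exists_isTail (hL hv)
      refine key 1 le_rfl (by omega) e he hv fun j hj => ?_
      rw [Nat.lt_one_iff.1 hj]
      exact he.1
  · have hMQ : laplacian (A.map ((↑) : ℕ → ℚ)) = M.map ((↑) : ℤ → ℚ) := by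
      have h1 : A.map ((↑) : ℕ → ℚ) = (A.map ((↑) : ℕ → ℤ)).map (Int.castRingHom ℚ) := by
        ext i j
        simp
      rw [h1, laplacian_map, ← hMA]
      rfl
    rw [hMQ]
    refine vecMul_eq_zero_iff_of_stronglyConnected (fun i => Nat.cast_pos.2 (hS'pos i)) ?_
      (fun i j hij => ?_) (fun i j hij hne => ?_) hconn
    · funext j
      simp only [Matrix.vecMul, dotProduct, Matrix.map_apply, Pi.zero_apply]
      exact_mod_cast hker j
    · exact Int.cast_nonpos.2 (hoff i j hij)
    · refine Int.cast_lt_zero.2 ?_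
      exact neg_pos.1 (Int.pos_iff_toNat_pos.2 hij)

end LatticeDeform

/-! ### Assembly of the theorem -/

open LatticeDeform in
theorem theorem3p1 {𝕜 : Type*} [Field 𝕜] (n : ℕ) (hn : 1 ≤ n)
    (L : AddSubgroup (Fin (n + 1) → ℤ)) (hL : L ≤ rootLattice n)
    (hfin : L.relIndex (rootLattice n) ≠ 0) (δ : ℝ) (hδ : 0 < δ) :
    -- the preprocessing is possible
    (∃ (A : Matrix (Fin (n + 1)) (Fin (n + 1)) ℕ) (S : Fin (n + 1) → ℕ),
      IsPreprocessed L A S) ∧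
    -- for every result of the preprocessing and all choices made afterwards:
    ∀ (A : Matrix (Fin (n + 1)) (Fin (n + 1)) ℕ) (S : Fin (n + 1) → ℕ), IsPreprocessed L A S →
      -- there is no infinite run
      (¬ ∃ run : ℕ → Matrix (Fin (n + 1)) (Fin (n + 1)) ℚ,
        run 0 = laplacian (A.map ((↑) : ℕ → ℚ)) ∧ ∀ r, Step S δ (run r) (run (r + 1))) ∧
      -- at every matrix `Q` that a run reaches:
      ∀ Q : Matrix (Fin (n + 1)) (Fin (n + 1)) ℚ,
        Relation.ReflTransGen (Step S δ) (laplacian (A.map ((↑) : ℕ → ℚ))) Q →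
        ∃ (l : ℚ) (M : Matrix (Fin (n + 1)) (Fin (n + 1)) ℤ)
          (A' : Matrix (Fin (n + 1)) (Fin (n + 1)) ℕ),
          -- `M = l • Q` is the Laplacian of a strongly connected digraph, with left kernel `S`
          IsScaling Q l M ∧ M = laplacian (A'.map ((↑) : ℕ → ℤ)) ∧ StronglyConnected A' ∧
          SpansLeftKernel Q S ∧
          -- the run is never stuck: every choice of `x`, `i`, then of `j`, can be continued
          (∀ x i, IsDefect M S x i →
            (∃ j, (x j : ℚ) / S j ≠ (x i : ℚ) / S i) ∧
            ∀ j, (x j : ℚ) / S j ≠ (x i : ℚ) / S i → ∃ ε, IsAdmissible S δ Q i j ε) ∧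
          -- if the algorithm stops at `Q`, its output is correct
          (HasFullSupport M S →
            dilate (l : ℝ) (rowLattice (Q.map ((↑) : ℚ → ℝ))) = toRealLattice (rowLattice M) ∧
            (∀ (T : Fin (n + 1) → Fin (n + 1) → Prop) (ρ : Equiv.Perm (Fin (n + 1))),
              IsSpanningTree A' T → IsLinearExtension T ρ →
              IsGroebnerBasis (grevlex ρ) (latticeIdeal 𝕜 (rowLattice M))
                (chipBinomials 𝕜 M S)) ∧
            IsGenericIdeal (latticeIdeal 𝕜 (rowLattice M)) ∧
            latticeDist (rowLattice (Q.map ((↑) : ℚ → ℝ))) (toRealLattice L) ≤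
              ENNReal.ofReal δ ∧
            ∃ t ∈ basisDistances (rowLattice (Q.map ((↑) : ℚ → ℝ))) (toRealLattice L),
              t ≤ δ) := by
  refine ⟨exists_isPreprocessed hn hL hfin, fun A S hp => ⟨fun ⟨run, _, hrun⟩ =>
    not_exists_infinite_run run hrun, fun Q hQ => ?_⟩⟩
  obtain ⟨e, he⟩ := exists_isDeformation_of_run hδ hp.pos hQ
  obtain ⟨l, M, hlM⟩ := exists_isScaling (he.exists_ne_zero hp.stronglyConnected hn)
  obtain ⟨A', hMA', hA'⟩ := he.exists_multidigraph hp.stronglyConnected hlM.1.1.1 hlM.2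
  refine ⟨l, M, A', hlM, hMA', hA', he.spansLeftKernel hp, fun x i hx => ⟨?_, fun j hj => ?_⟩,
    fun hfull => ?_⟩
  -- If all ratios `x k / S k` agree, then `x = x 0 • S` with `x 0 ≤ S 0 = 1`, so `x` is `0` or `S`,
  -- which a defect excludes.
  · by_contra! hall
    obtain ⟨hx0, hxS, -⟩ := hx
    have hS : ∀ k, (S k : ℚ) ≠ 0 := fun k => Nat.cast_ne_zero.2 (hp.pos k).ne'
    have hxk : ∀ k, (x k : ℚ) = x 0 * S k := fun k => by
      have h1 := (hall k).trans (hall 0).symm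
      rw [hp.zero, Nat.cast_one, div_one, div_eq_iff (hS k)] at h1
      exact h1
    have hxk' : ∀ k, x k = x 0 * S k := fun k => by exact_mod_cast hxk k
    have h01 : x 0 ≤ 1 := (hxS.le 0).trans hp.zero.le
    rcases Nat.le_one_iff_eq_zero_or_eq_one.1 h01 with h | h
    · refine hx0.ne' (funext fun k => ?_)
      rw [hxk' k, h, zero_mul]
      rfl
    · refine hxS.ne (funext fun k => ?_)
      rw [hxk' k, h, one_mul]
  · refine exists_isAdmissible hp.pos hδ Q ?_
    rintro rfl
    exact hj rfl
  · have hMS : (laplacian (A'.map ((↑) : ℕ → ℤ))).transpose.mulVec (fun i => (S i : ℤ)) = 0 := by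
      rw [← hMA']
      funext k
      have h1 := cast_firing hlM.2 S k
      have h2 : ratFiring Q S = 0 := by
        rw [ratFiring, Matrix.mulVec_transpose]
        exact he.vecMul_eq_zero hp
      rw [h2, Pi.zero_apply, mul_zero] at h1
      exact Int.cast_eq_zero.1 h1
    have hL' : toRealLattice L =
        rowLattice ((laplacian (A.map ((↑) : ℕ → ℚ))).map ((↑) : ℚ → ℝ)) := by
      rw [← hp.rows, toRealLattice_rowLattice]
      have h1 : A.map ((↑) : ℕ → ℚ) = (A.map ((↑) : ℕ → ℤ)).map (Int.castRingHom ℚ) := by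
        ext i j
        simp
      rw [h1, laplacian_map]
      congr 1
    have hdist : ∃ t ∈ basisDistances (rowLattice (Q.map ((↑) : ℚ → ℝ))) (toRealLattice L),
        t ≤ δ := by
      -- The two bases are the rows other than row `0` of `Q` and of the initial Laplacian; the
      -- latter is the deformation with `e = 0`.
      refine ⟨_, ⟨n, _, _, he.isLatticeBasis hp, ?_, rfl⟩, he.norm_le hδ hp.pos⟩
      rw [hL']
      exact (isDeformation_zero A S hδ).isLatticeBasis hp
    refine ⟨?_, fun T ρ hT hρ => ?_, ?_, ?_, hdist⟩
    · rw [dilate_rowLattice, toRealLattice_rowLattice]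
      congr 1
      ext i j
      have h1 : l * Q i j = M i j := congrFun (congrFun hlM.2 i) j
      simp only [Matrix.smul_apply, Matrix.map_apply, smul_eq_mul]
      exact_mod_cast congrArg ((↑) : ℚ → ℝ) h1
    · rw [hMA']
      exact isGroebnerBasis_chipBinomials hp.pos hp.zero hMS hT hρ
    · rw [hMA'] at hfull ⊢
      exact isGenericIdeal_of_hasFullSupport hp.pos hMS hfull
    · obtain ⟨t, ht, htδ⟩ := hdist
      exact iInf₂_le_of_le t ht (ENNReal.ofReal_le_ofReal htδ)
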